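/- Let $T>0$, let $X$ be a finite-dimensional real inner product space, and let $F:[0,T]\times X\to\mathbb{R}$ satisfy: (F0) $F\in C^1([0,T]\times X)$; (F1) for every $\rho>0$ the set $\{u\in X:\ \sup_{t\in[0,T]}|F(t,u)|\le\rho\}$ is bounded; (F2) there are $C_1,C_2>0$ with $|\partial_tF(t,u)|\le C_1(F(t,u)+C_2)$ for all $(t,u)\in[0,T]\times X$; (F3) for every $t\in[0,T]$ the critical set $\{u\in X:\ \nabla_xF(t,u)=0\}$ consists of isolated points. Let $u^0\in X$ and let $\varepsilon_j,\tau_j>0$ be sequences with $\varepsilon_j\to0$, $\tau_j\to0$ and $\varepsilon_j/\tau_j\to+\infty$. For each $j$ let $u_j^0=u^0$ and let $u_j^k$, $1\le k\le\lfloor T/\tau_j\rfloor$, satisfy $$u_j^k\in\operatorname*{argmin}_{x\in X}\Big\{F(k\tau_j,x)+\frac{\varepsilon_j}{2\tau_j}\|x-u_j^{k-1}\|^2\Big\}.$$ Let $\tilde u_j:[0,T]\to X$ be the piecewise constant interpolant: $\tilde u_j(0)=u^0$, $\tilde u_j(t)=u_j^k$ for $t\in((k-1)\tau_j,k\tau_j]$,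 $1\le k\le\lfloor T/\tau_j\rfloor$, and $\tilde u_j(t)=u_j^{\lfloor T/\tau_j\rfloor}$ for $t\in(\lfloor T/\tau_j\rfloor\tau_j,T]$. For $t\in[0,T]$ and $u_1,u_2\in X$ put $$c_t(u_1,u_2):=\inf\Big\{\int_0^1\|\dot\theta(s)\|\,\|\nabla_xF(t,\theta(s))\|\,ds:\ \theta\in AC([0,1];X),\ \theta(0)=u_1,\ \theta(1)=u_2\Big\}.$$ Then some subsequence of $(\tilde u_j)$ converges pointwise on $[0,T]$. Moreover, whenever a subsequence of $(\tilde u_j)$ converges to a function $u:[0,T]\to X$ at every point of $[0,T]$, the function $u$ is regulated, that is, the one-sided limits $u_-(t)$ and $u_+(t)$ exist for every $t\in[0,T]$ (with the conventions $u_-(0)=u(0)$ and $u_+(T)=u(T)$), and $$F(t,u_-(t))-F(t,u_+(t))=c_t(u_+(t),u_-(t))\qquad\text{for every }t\in[0,T].$$ -/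

import Mathlib

open Set Filter Topology

noncomputable section

namespace MinMov

variable {X : Type*} [NormedAddCommGroup X] [InnerProductSpace ℝ X] [FiniteDimensional ℝ X]

/-- The partial gradient `∇ₓ F(t, x)`; a finite-dimensional space is complete, which is what
Mathlib's `gradient` asks for. -/
def gradX (F : ℝ → X → ℝ) (t : ℝ) (x : X) : X :=
  haveI : CompleteSpace X := FiniteDimensional.complete ℝ X
  gradient (F t) x

/-- The partial derivative `∂ₜ F(t, x)` on the time interval `[0, T]` (one-sided at the ends). -/
def timeDeriv (T : ℝ) (F : ℝ → X → ℝ) (t : ℝ) (x : X) : ℝ :=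
  derivWithin (fun s => F s x) (Icc 0 T) t

/-- The set `𝒞(t)` of critical points of `F(t, ·)`. -/
def criticalSet (F : ℝ → X → ℝ) (t : ℝ) : Set X := {x | gradX F t x = 0}

/-- `sup_{t ∈ [0, T]} |F(t, x)|`. For `F` continuous on `[0, T] × X` this is a supremum of a
nonempty bounded set. -/
def supEnergy (T : ℝ) (F : ℝ → X → ℝ) (x : X) : ℝ := sSup ((fun t => |F t x|) '' Icc 0 T)

/-- The assumptions (F0)-(F3) on the driving energy `F : [0, T] × X → ℝ` (the values of `F` at
times outside `[0, T]` are irrelevant). -/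
structure EnergyAssumptions (T : ℝ) (F : ℝ → X → ℝ) : Prop where
  /-- `F` is of class `C¹` on `[0, T] × X`. -/
  contDiff : ContDiffOn ℝ 1 (fun p : ℝ × X => F p.1 p.2) (Icc 0 T ×ˢ univ)
  /-- The sublevels of `sup_t |F(t, ·)|` are bounded. -/
  bounded_sublevel : ∀ ρ : ℝ, 0 < ρ → Bornology.IsBounded {x : X | supEnergy T F x ≤ ρ}
  /-- Power control. -/
  power_control : ∃ C₁ > (0 : ℝ), ∃ C₂ > (0 : ℝ), ∀ t ∈ Icc 0 T, ∀ x : X,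
    |timeDeriv T F t x| ≤ C₁ * (F t x + C₂)
  /-- Critical points are isolated at each time. -/
  isolated : ∀ t ∈ Icc 0 T, ∀ x ∈ criticalSet F t, ∀ᶠ y in 𝓝[≠] x, y ∉ criticalSet F t

/-- `v 0, …, v ⌊T/τ⌋` is a solution of the minimizing movement scheme with time step `τ`,
viscosity `ε` and initial point `u₀`: `v (k + 1)` minimizes
`x ↦ F(t^{k+1}, x) + ε / (2 τ) ‖x - v k‖²` on `X`, where `t^{k+1} = (k + 1) τ`. -/
def IsDiscreteSolution (T : ℝ) (F : ℝ → X → ℝ) (u₀ : X) (ε τ : ℝ) (v : ℕ → X) : Prop :=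
  v 0 = u₀ ∧ ∀ k : ℕ, k < ⌊T / τ⌋₊ →
    IsMinOn (fun x => F (((k + 1 : ℕ) : ℝ) * τ) x + ε / (2 * τ) * ‖x - v k‖ ^ 2) univ (v (k + 1))

/-- The left-continuous piecewise constant interpolant on `[0, T]`: it is `v 0` at `t = 0`,
`v k` on `((k - 1) τ, k τ]` for `1 ≤ k ≤ ⌊T/τ⌋`, and it keeps the last value `v ⌊T/τ⌋` on
`(⌊T/τ⌋ τ, T]`. -/
def interpolant {Y : Type*} (T τ : ℝ) (v : ℕ → Y) (t : ℝ) : Y := v (min ⌈t / τ⌉₊ ⌊T / τ⌋₊)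

theorem interpolant_zero {Y : Type*} (T τ : ℝ) (v : ℕ → Y) : interpolant T τ v 0 = v 0 := by
  simp [interpolant]

theorem interpolant_eq {Y : Type*} {T τ : ℝ} (hτ : 0 < τ) (v : ℕ → Y) {k : ℕ} (hk : 1 ≤ k)
    (hkT : k ≤ ⌊T / τ⌋₊) {t : ℝ} (ht : t ∈ Ioc (((k : ℝ) - 1) * τ) (k * τ)) :
    interpolant T τ v t = v k := by
  have h : ⌈t / τ⌉₊ = k := by
    rw [Nat.ceil_eq_iff (by omega), lt_div_iff₀ hτ, div_le_iff₀ hτ, Nat.cast_sub hk, Nat.cast_one]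
    exact ht
  rw [interpolant, h, min_eq_left hkT]

/-- `l` is the left limit `u₋(t)` of `u : [0, T] → Y`, with the convention `u₋(0) = u(0)`. -/
def IsLeftLimit {Y : Type*} [TopologicalSpace Y] (u : ℝ → Y) (t : ℝ) (l : Y) : Prop :=
  (t = 0 ∧ l = u 0) ∨ (0 < t ∧ Tendsto u (𝓝[<] t) (𝓝 l))

/-- `l` is the right limit `u₊(t)` of `u : [0, T] → Y`, with the convention `u₊(T) = u(T)`. -/
def IsRightLimit {Y : Type*} [TopologicalSpace Y] (T : ℝ) (u : ℝ → Y) (t : ℝ) (l : Y) : Prop :=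
  (t = T ∧ l = u T) ∨ (t < T ∧ Tendsto u (𝓝[>] t) (𝓝 l))

/-- `u : [0, T] → Y` is regulated: it has both one-sided limits at every point of `[0, T]`. -/
def IsRegulated {Y : Type*} [TopologicalSpace Y] (T : ℝ) (u : ℝ → Y) : Prop :=
  ∀ t ∈ Icc 0 T, (∃ l, IsLeftLimit u t l) ∧ ∃ l, IsRightLimit T u t l

/-- The cost `c_t(u₁, u₂)`: the infimum of `∫₀¹ ‖θ'(s)‖ ‖∇ₓ F(t, θ(s))‖ ds` over the absolutely
continuous curves `θ : [0, 1] → X` from `u₁` to `u₂`. The set of competing values is nonempty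
and consists of nonnegative numbers. -/
def cost (F : ℝ → X → ℝ) (t : ℝ) (u₁ u₂ : X) : ℝ :=
  sInf {c : ℝ | ∃ θ : ℝ → X, AbsolutelyContinuousOnInterval θ 0 1 ∧ θ 0 = u₁ ∧ θ 1 = u₂ ∧
    c = ∫ s in (0 : ℝ)..1, ‖deriv θ s‖ * ‖gradX F t (θ s)‖}

end MinMov

end

namespace MinMov

open MeasureTheory

section Energy

variable {X : Type*} [NormedAddCommGroup X] [InnerProductSpace ℝ X] [FiniteDimensional ℝ X]
  {T : ℝ} {F : ℝ → X → ℝ}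

/-! ### Regularity of the energy -/

/-! All discrete states lie in one ball, and there `F` is `M`-Lipschitz in time, so the corrected
energy `F(t, ·) - M t` decreases along the scheme. The Euler equation of a step says that the slope
at the new state is `ε / τ` times the step length. Since `ε / τ → ∞`, steps become uniformly short,
and a step ending away from the critical points releases at least its length times the slope, up to
a small error.

Close to critical points the slope gives no uniform control, but (F3) leaves only finitely many of
them in the ball. `rel_of_steps` cuts out the part of the chain between the first and last visit to
a small ball around each, at a price of the order of the radius. Used with the distance, it yields
`exists_dist_le`: near a given time, a small energy release forces a small displacement, uniformly
along the sequence. Used with the length of curves weighted by the slope, it yields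
`exists_lipschitzCost`.

Compactness is then a Helly argument on the monotone corrected energies, which `exists_dist_le`
transfers to the states. The same transfer gives the limit `u` its one-sided limits. In the jump
identity, the cost dominates the energy drop by the chain rule along absolutely continuous curves
(`abs_sub_le_cost`), and the reverse inequality is `exists_lipschitzCost` passed to the limit
(`cost_le`). -/

theorem EnergyAssumptions.continuousOn (hF : EnergyAssumptions T F) :
    ContinuousOn (fun p : ℝ × X => F p.1 p.2) (Icc 0 T ×ˢ univ) :=
  hF.contDiff.continuousOn

theorem EnergyAssumptions.hasFDerivWithinAt (hF : EnergyAssumptions T F) {t : ℝ}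
    (ht : t ∈ Icc 0 T) (x : X) :
    HasFDerivWithinAt (fun p : ℝ × X => F p.1 p.2)
      (fderivWithin ℝ (fun p : ℝ × X => F p.1 p.2) (Icc 0 T ×ˢ univ) (t, x))
      (Icc 0 T ×ˢ univ) (t, x) :=
  (hF.contDiff.differentiableOn one_ne_zero (t, x) ⟨ht, mem_univ x⟩).hasFDerivWithinAt

theorem EnergyAssumptions.hasFDerivAt (hF : EnergyAssumptions T F) {t : ℝ}
    (ht : t ∈ Icc 0 T) (x : X) :
    HasFDerivAt (F t) ((fderivWithin ℝ (fun p : ℝ × X => F p.1 p.2)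
      (Icc 0 T ×ˢ univ) (t, x)).comp (ContinuousLinearMap.inr ℝ ℝ X)) x := by
  rw [← hasFDerivWithinAt_univ]
  exact (hF.hasFDerivWithinAt ht x).comp x (hasFDerivAt_prodMk_right t x).hasFDerivWithinAt
    (fun y _ => ⟨ht, mem_univ y⟩)

theorem EnergyAssumptions.hasGradientAt (hF : EnergyAssumptions T F) {t : ℝ}
    (ht : t ∈ Icc 0 T) (x : X) : HasGradientAt (F t) (gradX F t x) x :=
  (hF.hasFDerivAt ht x).differentiableAt.hasGradientAt

theorem EnergyAssumptions.continuousOn_fderivWithin (hT : 0 < T) (hF : EnergyAssumptions T F) :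
    ContinuousOn (fderivWithin ℝ (fun p : ℝ × X => F p.1 p.2) (Icc 0 T ×ˢ univ))
      (Icc 0 T ×ˢ univ) :=
  hF.contDiff.continuousOn_fderivWithin
    ((uniqueDiffOn_Icc hT).prod uniqueDiffOn_univ) le_rfl

theorem EnergyAssumptions.continuousOn_gradX (hT : 0 < T) (hF : EnergyAssumptions T F) :
    ContinuousOn (fun p : ℝ × X => gradX F p.1 p.2) (Icc 0 T ×ˢ univ) := by
  have h : ContinuousOn (fun p : ℝ × X => (InnerProductSpace.toDual ℝ X).symm
      ((fderivWithin ℝ (fun p : ℝ × X => F p.1 p.2) (Icc 0 T ×ˢ univ) p).comp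
        (ContinuousLinearMap.inr ℝ ℝ X))) (Icc 0 T ×ˢ univ) :=
    (InnerProductSpace.toDual ℝ X).symm.continuous.comp_continuousOn
      ((hF.continuousOn_fderivWithin hT).clm_comp continuousOn_const)
  refine h.congr fun p hp => ?_
  simp only [gradX, gradient]
  rw [(hF.hasFDerivAt hp.1 p.2).fderiv]

theorem EnergyAssumptions.continuous_gradX (hT : 0 < T) (hF : EnergyAssumptions T F) {t : ℝ}
    (ht : t ∈ Icc 0 T) : Continuous (gradX F t) :=
  (hF.continuousOn_gradX hT).comp_continuous (f := fun x => (t, x)) (by fun_prop)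
    fun x => ⟨ht, mem_univ x⟩

theorem EnergyAssumptions.hasDerivWithinAt_fderivWithin (hF : EnergyAssumptions T F) {t : ℝ}
    (ht : t ∈ Icc 0 T) (x : X) :
    HasDerivWithinAt (fun s => F s x)
      (fderivWithin ℝ (fun p : ℝ × X => F p.1 p.2) (Icc 0 T ×ˢ univ) (t, x) (1, 0))
      (Icc 0 T) t := by
  have h := (hF.hasFDerivWithinAt ht x).comp (f := fun s : ℝ => (s, x)) (s := Icc 0 T) t
    (hasFDerivAt_prodMk_left t x).hasFDerivWithinAt (fun s hs => ⟨hs, mem_univ x⟩)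
  exact h.hasDerivWithinAt.congr_deriv (by simp)

theorem EnergyAssumptions.hasDerivWithinAt (hF : EnergyAssumptions T F) {t : ℝ}
    (ht : t ∈ Icc 0 T) (x : X) :
    HasDerivWithinAt (fun s => F s x) (timeDeriv T F t x) (Icc 0 T) t :=
  (hF.hasDerivWithinAt_fderivWithin ht x).differentiableWithinAt.hasDerivWithinAt

/-- The time derivative is continuous, hence bounded on the compact set `[0, T] × closedBall 0 R`.
The constant `M` bounds the work done on bounded states and is what makes the corrected energy
monotone. -/
theorem EnergyAssumptions.exists_time_lipschitz (hT : 0 < T) (hF : EnergyAssumptions T F)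
    (R : ℝ) : ∃ M : ℝ, 0 ≤ M ∧ ∀ x : X, ‖x‖ ≤ R → ∀ s ∈ Icc 0 T, ∀ t ∈ Icc 0 T,
      |F t x - F s x| ≤ M * |t - s| := by
  have hK : IsCompact (Icc 0 T ×ˢ Metric.closedBall (0 : X) R) :=
    isCompact_Icc.prod (isCompact_closedBall _ _)
  obtain ⟨M, hM⟩ := hK.exists_bound_of_continuousOn
    (((hF.continuousOn_fderivWithin hT).clm_apply
      (continuousOn_const (c := ((1 : ℝ), (0 : X))))).mono
      (prod_mono Subset.rfl (subset_univ _)))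
  refine ⟨max M 0, le_max_right _ _, fun x hx s hs t ht => ?_⟩
  refine (convex_Icc (0 : ℝ) T).norm_image_sub_le_of_norm_hasDerivWithin_le
    (fun r hr => hF.hasDerivWithinAt_fderivWithin hr x) (fun r hr => ?_) hs ht
  exact (hM (r, x) ⟨hr, by simpa using hx⟩).trans (le_max_left _ _)

/-- A function with `|g'| ≤ C g` on an interval grows at most exponentially. -/
theorem le_exp_mul_of_abs_deriv_le {g g' : ℝ → ℝ} {C a b : ℝ}
    (hg : ∀ t ∈ Icc a b, HasDerivWithinAt g (g' t) (Icc a b) t)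
    (hb : ∀ t ∈ Icc a b, |g' t| ≤ C * g t) {s t : ℝ} (hs : s ∈ Icc a b) (ht : t ∈ Icc a b) :
    g t ≤ Real.exp (C * |t - s|) * g s := by
  -- `σ = -1` gives the bound forward in time, `σ = 1` backward.
  have key : ∀ σ : ℝ, |σ| = 1 →
      ∀ t ∈ Icc a b, HasDerivWithinAt (fun t => Real.exp (σ * C * t) * g t)
        (Real.exp (σ * C * t) * (σ * C * g t + g' t)) (Icc a b) t := by
    intro σ _ t ht
    have h1 : HasDerivWithinAt (fun t => Real.exp (σ * C * t))
        (Real.exp (σ * C * t) * (σ * C * 1)) (Icc a b) t :=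
      (((hasDerivAt_id t).const_mul (σ * C)).exp).hasDerivWithinAt
    exact (h1.mul (hg t ht)).congr_deriv (by ring)
  have hanti : AntitoneOn (fun t => Real.exp ((-1) * C * t) * g t) (Icc a b) := by
    refine antitoneOn_of_hasDerivWithinAt_nonpos (convex_Icc a b)
      (fun t ht => (key (-1) (by simp) t ht).continuousWithinAt)
      (fun t ht => (key (-1) (by simp) t (interior_subset ht)).mono interior_subset)
      fun t ht => ?_
    have := abs_le.1 (hb t (interior_subset ht))
    exact mul_nonpos_of_nonneg_of_nonpos (Real.exp_pos _).le (by linarith)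
  have hmono : MonotoneOn (fun t => Real.exp (1 * C * t) * g t) (Icc a b) := by
    refine monotoneOn_of_hasDerivWithinAt_nonneg (convex_Icc a b)
      (fun t ht => (key 1 (by simp) t ht).continuousWithinAt)
      (fun t ht => (key 1 (by simp) t (interior_subset ht)).mono interior_subset)
      fun t ht => ?_
    have := abs_le.1 (hb t (interior_subset ht))
    exact mul_nonneg (Real.exp_pos _).le (by linarith)
  rcases le_total s t with h | h
  · have h1 := hanti hs ht h
    simp only at h1
    rw [abs_of_nonneg (sub_nonneg.2 h), mul_sub, sub_eq_add_neg, Real.exp_add, mul_assoc]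
    calc g t = Real.exp (C * t) * (Real.exp (-1 * C * t) * g t) := by
          rw [← mul_assoc, ← Real.exp_add]; simp
      _ ≤ Real.exp (C * t) * (Real.exp (-1 * C * s) * g s) := by gcongr
      _ = _ := by ring_nf
  · have h1 := hmono ht hs h
    simp only at h1
    rw [abs_of_nonpos (sub_nonpos.2 h), neg_sub, mul_sub, sub_eq_neg_add, Real.exp_add, mul_assoc]
    calc g t = Real.exp (-(C * t)) * (Real.exp (1 * C * t) * g t) := by
          rw [← mul_assoc, ← Real.exp_add]; simp
      _ ≤ Real.exp (-(C * t)) * (Real.exp (1 * C * s) * g s) := by gcongr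
      _ = _ := by ring_nf

/-- Power control forces `F + C₂ ≥ 0`, being an upper bound for an absolute value; Grönwall applied
to `F + C₂` then compares any two times, in either order. -/
theorem EnergyAssumptions.exists_gronwall (hF : EnergyAssumptions T F) :
    ∃ C₁ > (0 : ℝ), ∃ C₂ > (0 : ℝ), (∀ t ∈ Icc 0 T, ∀ x, 0 ≤ F t x + C₂) ∧
      ∀ s ∈ Icc 0 T, ∀ t ∈ Icc 0 T, ∀ x,
        F t x + C₂ ≤ Real.exp (C₁ * |t - s|) * (F s x + C₂) := by
  obtain ⟨C₁, h1, C₂, h2, h⟩ := hF.power_control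
  refine ⟨C₁, h1, C₂, h2, fun t ht x => ?_, fun s hs t ht x => ?_⟩
  · exact nonneg_of_mul_nonneg_right ((abs_nonneg _).trans (h t ht x)) h1
  · exact le_exp_mul_of_abs_deriv_le (g := fun t => F t x + C₂)
      (fun r hr => (hF.hasDerivWithinAt hr x).add_const C₂) (fun r hr => h r hr x) hs ht

theorem mul_mem_Icc_of_le_floor {τ : ℝ} (hτ : 0 < τ) (hT : 0 ≤ T) {k : ℕ} (hk : k ≤ ⌊T / τ⌋₊) :
    (k : ℝ) * τ ∈ Icc 0 T :=
  ⟨by positivity, (le_div_iff₀ hτ).1 ((Nat.le_floor_iff (by positivity)).1 hk)⟩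

/-- The discrete solutions stay in a ball that depends only on the energy and on the initial
point. -/
theorem EnergyAssumptions.exists_norm_le (hT : 0 < T) (hF : EnergyAssumptions T F) (u₀ : X) :
    ∃ R : ℝ, ∀ ε τ : ℝ, 0 < ε → 0 < τ → ∀ v : ℕ → X, IsDiscreteSolution T F u₀ ε τ v →
      ∀ k ≤ ⌊T / τ⌋₊, ‖v k‖ ≤ R := by
  obtain ⟨C₁, h1, C₂, h2, hpos, hgr⟩ := hF.exists_gronwall
  have h0 : (0 : ℝ) ∈ Icc 0 T := ⟨le_rfl, hT.le⟩
  -- One exponential accounts for growth along the scheme up to time `k τ`, the other for passing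
  -- from `k τ` to an arbitrary time at the fixed state `v k`.
  set A := Real.exp (C₁ * T) * (Real.exp (C₁ * T) * (F 0 u₀ + C₂)) with hA
  have hA0 : 0 ≤ A := by have := hpos 0 h0 u₀; positivity
  obtain ⟨R, hR⟩ := (hF.bounded_sublevel (A + C₂) (by linarith)).exists_norm_le
  refine ⟨R, fun ε τ hε hτ v hv k hk => hR _ ?_⟩
  have hstep : ∀ k ≤ ⌊T / τ⌋₊,
      F (k * τ) (v k) + C₂ ≤ Real.exp (C₁ * (k * τ)) * (F 0 u₀ + C₂) := by
    intro k
    induction k with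
    | zero => intro _; simp [hv.1]
    | succ k ih =>
      intro hk
      have hk' : k ≤ ⌊T / τ⌋₊ := by omega
      have hmin := hv.2 k (by omega) (mem_univ (v k))
      simp only [mem_ofPred_eq, sub_self, norm_zero] at hmin
      have hnn : 0 ≤ ε / (2 * τ) * ‖v (k + 1) - v k‖ ^ 2 := by positivity
      have hg := hgr _ (mul_mem_Icc_of_le_floor hτ hT.le hk') _
        (mul_mem_Icc_of_le_floor hτ hT.le hk) (v k)
      have habs : |((k + 1 : ℕ) : ℝ) * τ - k * τ| = τ := by
        rw [← sub_mul]; push_cast; simp [abs_of_pos hτ]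
      rw [habs] at hg
      calc F ((k + 1 : ℕ) * τ) (v (k + 1)) + C₂ ≤ F ((k + 1 : ℕ) * τ) (v k) + C₂ := by
            norm_num at hmin ⊢; linarith
        _ ≤ Real.exp (C₁ * τ) * (F (k * τ) (v k) + C₂) := hg
        _ ≤ Real.exp (C₁ * τ) * (Real.exp (C₁ * (k * τ)) * (F 0 u₀ + C₂)) := by
            gcongr; exact ih hk'
        _ = _ := by rw [← mul_assoc, ← Real.exp_add]; push_cast; ring_nf
  have hkT := mul_mem_Icc_of_le_floor hτ hT.le hk
  change sSup ((fun t => |F t (v k)|) '' Icc 0 T) ≤ A + C₂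
  refine csSup_le ((nonempty_Icc.2 hT.le).image _) ?_
  rintro _ ⟨t, ht, rfl⟩
  have hA' : F t (v k) + C₂ ≤ A := by
    refine (hgr _ hkT t ht (v k)).trans ?_
    have hd : |t - k * τ| ≤ T := abs_le.2 ⟨by linarith [ht.1, hkT.2], by linarith [ht.2, hkT.1]⟩
    have := hpos 0 h0 u₀
    have := hpos _ hkT (v k)
    rw [hA]
    gcongr
    refine (hstep k hk).trans ?_
    gcongr
    exact hkT.2
  exact abs_le.2 ⟨by linarith [hpos t ht (v k)], by linarith⟩

end Energy

/-! ### Absolutely continuous curves -/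

section AbsolutelyContinuous

theorem _root_.LipschitzOnWith.comp_absolutelyContinuousOnInterval {X Y : Type*}
    [PseudoMetricSpace X] [PseudoMetricSpace Y] {f : ℝ → X} {g : X → Y} {S : Set X}
    {K : NNReal} {a b : ℝ} (hg : LipschitzOnWith K g S)
    (hf : AbsolutelyContinuousOnInterval f a b) (hS : MapsTo f (uIcc a b) S) :
    AbsolutelyContinuousOnInterval (g ∘ f) a b := by
  rw [absolutelyContinuousOnInterval_iff] at hf ⊢
  intro ε hε
  obtain ⟨δ, hδ, h⟩ := hf (ε / (K + 1)) (by positivity)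
  refine ⟨δ, hδ, fun E hE hlen => ?_⟩
  calc ∑ i ∈ Finset.range E.1, dist ((g ∘ f) (E.2 i).1) ((g ∘ f) (E.2 i).2)
      ≤ ∑ i ∈ Finset.range E.1, (K + 1) * dist (f (E.2 i).1) (f (E.2 i).2) := by
        refine Finset.sum_le_sum fun i hi => ?_
        have h1 := hE.1 i hi
        refine (hg.dist_le_mul _ (hS h1.1) _ (hS h1.2)).trans ?_
        gcongr
        linarith
    _ = (K + 1) * ∑ i ∈ Finset.range E.1, dist (f (E.2 i).1) (f (E.2 i).2) := by
        rw [Finset.mul_sum]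
    _ < (K + 1) * (ε / (K + 1)) := by
        have := h E hE hlen
        gcongr
    _ = ε := by field_simp

variable {X : Type*} [NormedAddCommGroup X] [InnerProductSpace ℝ X] [FiniteDimensional ℝ X]

/-- The norm of the derivative is at most the sum of the absolute values of its coordinates in an
orthonormal basis, which reduces the claim to real-valued functions. -/
theorem _root_.AbsolutelyContinuousOnInterval.intervalIntegrable_norm_deriv {f : ℝ → X} {a b : ℝ}
    (hf : AbsolutelyContinuousOnInterval f a b) :
    IntervalIntegrable (fun s => ‖deriv f s‖) volume a b := by
  set e := stdOrthonormalBasis ℝ X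
  have hi : ∀ i, AbsolutelyContinuousOnInterval (fun s => innerSL ℝ (e i) (f s)) a b := fun i =>
    ((innerSL ℝ (e i)).lipschitz.lipschitzOnWith (s := univ)).comp_absolutelyContinuousOnInterval
      hf (mapsTo_univ _ _)
  have hsum : IntervalIntegrable
      (∑ i, fun s => |deriv (fun s => innerSL ℝ (e i) (f s)) s|) volume a b :=
    IntervalIntegrable.sum _ fun i _ => (hi i).intervalIntegrable_deriv.abs
  refine hsum.mono_fun (stronglyMeasurable_deriv f).norm.aestronglyMeasurable ?_
  have hd := hf.boundedVariationOn.ae_differentiableAt_of_mem_uIcc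
  rw [Filter.EventuallyLE, ae_restrict_iff' measurableSet_uIoc]
  filter_upwards [hd] with s hs hmem
  have hds := (hs (uIoc_subset_uIcc hmem)).hasDerivAt
  rw [norm_norm, Finset.sum_apply]
  have heq : ∀ i, deriv (fun s => innerSL ℝ (e i) (f s)) s = inner ℝ (e i) (deriv f s) :=
    fun i => ((innerSL ℝ (e i)).hasFDerivAt.comp_hasDerivAt s hds).deriv
  simp only [heq]
  refine le_trans ?_ (le_abs_self _)
  conv_lhs => rw [← e.sum_repr (deriv f s)]
  refine (norm_sum_le _ _).trans (Finset.sum_le_sum fun i _ => ?_)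
  rw [norm_smul, e.norm_eq_one, mul_one, e.repr_apply_apply, Real.norm_eq_abs]

/-- Along an absolutely continuous curve a `C¹` function varies by at most the integral of the
speed times the slope. -/
theorem abs_sub_le_integral_of_absolutelyContinuous {φ : X → ℝ} {G : X → X}
    (hφ : ∀ x, HasGradientAt φ (G x) x) (hG : Continuous G) {θ : ℝ → X} {a b : ℝ} (hab : a ≤ b)
    (hθ : AbsolutelyContinuousOnInterval θ a b) :
    |φ (θ b) - φ (θ a)| ≤ ∫ s in a..b, ‖deriv θ s‖ * ‖G (θ s)‖ := by
  obtain ⟨R, hR⟩ := hθ.exists_bound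
  obtain ⟨M, hM⟩ := (isCompact_closedBall (0 : X) R).exists_bound_of_continuousOn hG.continuousOn
  -- `φ` is only locally Lipschitz; a ball containing the whole curve suffices.
  have hlip : LipschitzOnWith M.toNNReal φ (Metric.closedBall 0 R) := by
    refine (convex_closedBall (0 : X) R).lipschitzOnWith_of_nnnorm_hasFDerivWithin_le
      (fun x _ => (hφ x).hasFDerivAt.hasFDerivWithinAt) fun x hx => ?_
    rw [← NNReal.coe_le_coe, coe_nnnorm, LinearIsometryEquiv.norm_map]
    exact (hM x hx).trans (Real.le_coe_toNNReal M)
  have hac : AbsolutelyContinuousOnInterval (φ ∘ θ) a b :=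
    hlip.comp_absolutelyContinuousOnInterval hθ fun s hs => by simpa using hR s hs
  have hint : IntervalIntegrable (fun s => ‖deriv θ s‖ * ‖G (θ s)‖) volume a b :=
    hθ.intervalIntegrable_norm_deriv.mul_continuousOn
      (hG.norm.comp_continuousOn hθ.continuousOn)
  have hd := hθ.boundedVariationOn.ae_differentiableAt_of_mem_uIcc
  have hle := intervalIntegral.norm_integral_le_of_norm_le hab (f := deriv (φ ∘ θ)) (μ := volume)
    (by
      filter_upwards [hd] with s hs hmem
      have hds := (hs (by rw [uIcc_of_le hab]; exact Ioc_subset_Icc_self hmem)).hasDerivAt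
      have h1 := ((hφ (θ s)).hasFDerivAt.comp_hasDerivAt s hds).deriv
      rw [h1, InnerProductSpace.toDual_apply_apply, mul_comm]
      exact norm_inner_le_norm _ _) hint
  rw [hac.integral_deriv_eq_sub, Real.norm_eq_abs] at hle
  exact hle

end AbsolutelyContinuous

/-! ### Costs of Lipschitz curves -/

section LipschitzCost

variable {X : Type*} [NormedAddCommGroup X] [InnerProductSpace ℝ X] [FiniteDimensional ℝ X]

/-- The points `x` and `y` are joined by a Lipschitz curve whose length for the weight `g` is at
most `c`. -/
def LipschitzCost (g : X → ℝ) (x y : X) (c : ℝ) : Prop :=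
  ∃ (K : NNReal) (θ : ℝ → X), LipschitzWith K θ ∧ θ 0 = x ∧ θ 1 = y ∧
    ∫ s in (0 : ℝ)..1, ‖deriv θ s‖ * g (θ s) ≤ c

omit [FiniteDimensional ℝ X] in
theorem LipschitzCost.mono {g : X → ℝ} {x y : X} {c d : ℝ} (h : LipschitzCost g x y c)
    (hcd : c ≤ d) : LipschitzCost g x y d := by
  obtain ⟨K, θ, hK, h0, h1, hc⟩ := h
  exact ⟨K, θ, hK, h0, h1, hc.trans hcd⟩

theorem _root_.LipschitzWith.intervalIntegrable_norm_deriv_mul {θ : ℝ → X} {K : NNReal}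
    (hθ : LipschitzWith K θ) {g : X → ℝ} (hg : Continuous g) (a b : ℝ) :
    IntervalIntegrable (fun s => ‖deriv θ s‖ * g (θ s)) volume a b :=
  (hθ.lipschitzOnWith.absolutelyContinuousOnInterval.intervalIntegrable_norm_deriv).mul_continuousOn
    (hg.comp hθ.continuous).continuousOn

theorem LipschitzCost.trans {g : X → ℝ} (hg : Continuous g) {x y z : X} {c d : ℝ}
    (h₁ : LipschitzCost g x y c) (h₂ : LipschitzCost g y z d) :
    LipschitzCost g x z (c + d) := by
  obtain ⟨K₁, θ₁, hK₁, h₁0, h₁1, hc⟩ := h₁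
  obtain ⟨K₂, θ₂, hK₂, h₂0, h₂1, hd⟩ := h₂
  -- On each half of the interval the other curve is frozen at the junction `y`, which is
  -- subtracted; this single formula is visibly Lipschitz.
  set θ : ℝ → X := fun s => θ₁ (min (2 * s) 1) + θ₂ (max (2 * s - 1) 0) - y with hθ
  have hleft : ∀ s ≤ (1 / 2 : ℝ), θ s = θ₁ (2 * s) := fun s hs => by
    simp only [hθ]
    rw [min_eq_left (by linarith), max_eq_right (by linarith), h₂0, add_sub_cancel_right]
  have hright : ∀ s ≥ (1 / 2 : ℝ), θ s = θ₂ (2 * s - 1) := fun s hs => by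
    simp only [hθ]
    rw [min_eq_right (by linarith), max_eq_left (by linarith), h₁1, add_sub_cancel_left]
  have hmul : LipschitzWith 2 (fun s : ℝ => 2 * s) := LipschitzWith.of_dist_le_mul fun a b => by
    rw [Real.dist_eq, Real.dist_eq, ← mul_sub, abs_mul]; simp
  have hsub : LipschitzWith 2 (fun s : ℝ => 2 * s - 1) :=
    LipschitzWith.of_dist_le_mul fun a b => by
      rw [Real.dist_eq, Real.dist_eq, sub_sub_sub_cancel_right, ← mul_sub, abs_mul]; simp
  have hlip : LipschitzWith (K₁ * 2 + K₂ * 2 + 0) θ :=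
    ((hK₁.comp (hmul.min_const 1)).add (hK₂.comp (hsub.max_const 0))).sub (LipschitzWith.const y)
  refine ⟨_, θ, hlip, ?_, ?_, ?_⟩
  · rw [hleft 0 (by norm_num), mul_zero, h₁0]
  · rw [hright 1 (by norm_num)]; norm_num [h₂1]
  have hI := hlip.intervalIntegrable_norm_deriv_mul hg
  rw [← intervalIntegral.integral_add_adjacent_intervals (hI 0 (1 / 2)) (hI (1 / 2) 1)]
  have hne : ∀ᵐ s : ℝ, s ≠ 1 / 2 := Measure.ae_ne volume _
  refine add_le_add (le_trans (le_of_eq ?_) hc) (le_trans (le_of_eq ?_) hd)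
  · have h := intervalIntegral.integral_comp_mul_left (a := 0) (b := 1 / 2)
      (fun s => ‖deriv θ₁ s‖ * g (θ₁ s)) (two_ne_zero (α := ℝ))
    rw [mul_zero, mul_one_div_cancel two_ne_zero, smul_eq_mul, eq_inv_mul_iff_mul_eq₀ two_ne_zero,
      ← intervalIntegral.integral_const_mul] at h
    rw [← h]
    refine intervalIntegral.integral_congr_ae ?_
    filter_upwards [hne] with s hs hmem
    rw [uIoc_of_le (by norm_num)] at hmem
    have hlt : s < 1 / 2 := lt_of_le_of_ne hmem.2 hs
    have hev : θ =ᶠ[𝓝 s] fun s => θ₁ (2 * s) := by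
      filter_upwards [gt_mem_nhds hlt] with r hr using hleft r hr.le
    rw [hev.deriv_eq, deriv_comp_mul_left, hleft s hlt.le, norm_smul]
    norm_num
    ring
  · have h := intervalIntegral.integral_comp_mul_sub (a := 1 / 2) (b := 1)
      (fun s => ‖deriv θ₂ s‖ * g (θ₂ s)) (two_ne_zero (α := ℝ)) 1
    rw [mul_one_div_cancel two_ne_zero, sub_self, show (2 : ℝ) * 1 - 1 = 1 by norm_num,
      smul_eq_mul, eq_inv_mul_iff_mul_eq₀ two_ne_zero,
      ← intervalIntegral.integral_const_mul] at h
    rw [← h]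
    refine intervalIntegral.integral_congr_ae ?_
    filter_upwards with s hmem
    rw [uIoc_of_le (by norm_num)] at hmem
    have hlt : 1 / 2 < s := hmem.1
    have hev : θ =ᶠ[𝓝 s] fun s => θ₂ (2 * s - 1) := by
      filter_upwards [lt_mem_nhds hlt] with r hr using hright r hr.le
    have hder := deriv_comp_mul_left 2 (fun s => θ₂ (s - 1)) s
    rw [deriv_comp_sub_const] at hder
    rw [hev.deriv_eq, hder, hright s hlt.le, norm_smul]
    norm_num
    ring

omit [FiniteDimensional ℝ X] in
theorem lipschitzCost_of_segment {g : X → ℝ} {x y : X} {c : ℝ} (hg : ∀ z, 0 ≤ g z)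
    (h : ∀ z ∈ segment ℝ x y, ‖y - x‖ * g z ≤ c) : LipschitzCost g x y c := by
  have hlip : LipschitzWith (nndist x y) (AffineMap.lineMap x y : ℝ → X) :=
    lipschitzWith_lineMap x y
  refine ⟨_, fun s => AffineMap.lineMap x y s, hlip, by simp, by simp, ?_⟩
  have hder : ∀ s : ℝ, deriv (fun s => (AffineMap.lineMap x y : ℝ → X) s) s = y - x := fun s =>
    AffineMap.hasDerivAt_lineMap.deriv
  simp only [hder]
  have := intervalIntegral.norm_integral_le_of_norm_le_const (a := 0) (b := 1) (C := c)
    (f := fun s => ‖y - x‖ * g (AffineMap.lineMap x y s)) fun s hs => by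
      rw [uIoc_of_le zero_le_one] at hs
      rw [Real.norm_of_nonneg (mul_nonneg (norm_nonneg _) (hg _))]
      exact h _ (by
        rw [segment_eq_image_lineMap]
        exact mem_image_of_mem _ (Ioc_subset_Icc_self hs))
  rw [sub_zero, abs_one, mul_one] at this
  exact (le_abs_self _).trans this

variable {T : ℝ} {F : ℝ → X → ℝ}

theorem cost_le_of_lipschitzCost {t : ℝ} {x y : X} {c : ℝ}
    (h : LipschitzCost (fun z => ‖gradX F t z‖) x y c) : cost F t x y ≤ c := by
  obtain ⟨K, θ, hK, h0, h1, hc⟩ := h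
  have hbdd : BddBelow {c : ℝ | ∃ θ : ℝ → X, AbsolutelyContinuousOnInterval θ 0 1 ∧ θ 0 = x ∧
      θ 1 = y ∧ c = ∫ s in (0 : ℝ)..1, ‖deriv θ s‖ * ‖gradX F t (θ s)‖} := by
    refine ⟨0, ?_⟩
    rintro _ ⟨θ, -, -, -, rfl⟩
    exact intervalIntegral.integral_nonneg zero_le_one fun s _ => by positivity
  exact (csInf_le hbdd
    ⟨θ, hK.lipschitzOnWith.absolutelyContinuousOnInterval, h0, h1, rfl⟩).trans hc

/-- Lower bound for the cost, from the chain rule along each competitor. The segment shows that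
competitors exist, so the infimum is not the default value of `sInf ∅`. -/
theorem EnergyAssumptions.abs_sub_le_cost (hT : 0 < T) (hF : EnergyAssumptions T F) {t : ℝ}
    (ht : t ∈ Icc 0 T) (x y : X) : |F t y - F t x| ≤ cost F t x y := by
  have hne : {c : ℝ | ∃ θ : ℝ → X, AbsolutelyContinuousOnInterval θ 0 1 ∧ θ 0 = x ∧ θ 1 = y ∧
      c = ∫ s in (0 : ℝ)..1, ‖deriv θ s‖ * ‖gradX F t (θ s)‖}.Nonempty :=
    ⟨_, fun s => AffineMap.lineMap x y s,
      (lipschitzWith_lineMap x y).lipschitzOnWith.absolutelyContinuousOnInterval,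
      by simp, by simp, rfl⟩
  refine le_csInf hne ?_
  rintro _ ⟨θ, hθ, rfl, rfl, rfl⟩
  exact abs_sub_le_integral_of_absolutelyContinuous (hF.hasGradientAt ht)
    (hF.continuous_gradX hT ht) zero_le_one hθ

end LipschitzCost

/-! ### Chains with finitely many exceptional sets -/

/-- Let `R` be an additive relation. If each step of a chain either is controlled by the decrease
of `E` or stays in one of finitely many sets on which `R` is controlled by `σ`, then cutting the
chain between its first and its last visit to each of these sets controls the whole chain. -/
theorem rel_of_steps {X ι : Type*} {R : X → X → ℝ → Prop}
    (hrefl : ∀ x, R x x 0) (hmono : ∀ {x y c d}, R x y c → c ≤ d → R x y d)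
    (htrans : ∀ {x y z c d}, R x y c → R y z d → R x z (c + d))
    {x : ℕ → X} {E : ℕ → ℝ} {N : ι → Set X} {σ : ℝ} (hσ : 0 ≤ σ) {b : ℕ} (n : ℕ) :
    ∀ (S : Finset ι) (a : ℕ), a + n = b →
      (∀ p ∈ S, ∀ y ∈ N p, ∀ z ∈ N p, R y z σ) →
      (∀ k, a ≤ k → k < b → E (k + 1) ≤ E k) →
      (∀ k, a ≤ k → k < b → (∃ p ∈ S, x k ∈ N p ∧ x (k + 1) ∈ N p) ∨
        R (x k) (x (k + 1)) (E k - E (k + 1))) →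
      R (x a) (x b) (E a - E b + S.card * σ) := by
  classical
  -- Strong induction on the length of the chain, since removing a set may skip many steps at once.
  induction n using Nat.strong_induction_on with
  | _ n ih =>
  intro S a hab hN hE hstep
  rcases Nat.eq_zero_or_pos n with rfl | hn
  · obtain rfl : a = b := by omega
    exact hmono (hrefl _) (by rw [sub_self, zero_add]; positivity)
  rcases hstep a le_rfl (by omega) with ⟨p, hp, hap, hap'⟩ | hgood
  · let Q : Finset ℕ := (Finset.Ico a b).filter fun k => x (k + 1) ∈ N p
    have hQ : Q.Nonempty :=
      ⟨a, Finset.mem_filter.2 ⟨Finset.mem_Ico.2 ⟨le_rfl, by omega⟩, hap'⟩⟩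
    set l := Q.max' hQ with hl
    have hlQ := Finset.mem_filter.1 (Q.max'_mem hQ)
    rw [← hl, Finset.mem_Ico] at hlQ
    have hR := ih (b - (l + 1)) (by omega) (S.erase p) (l + 1) (by omega)
      (fun q hq => hN q (Finset.mem_of_mem_erase hq)) (fun k hk => hE k (by omega))
      fun k hk hkb => (hstep k (by omega) hkb).imp_left fun ⟨q, hq, h1, h2⟩ =>
        ⟨q, Finset.mem_erase.2 ⟨by
          rintro rfl
          have : k ≤ l := Q.le_max' k
            (Finset.mem_filter.2 ⟨Finset.mem_Ico.2 ⟨by omega, hkb⟩, h2⟩)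
          omega, hq⟩, h1, h2⟩
    refine hmono (htrans (hN p hp _ hap _ hlQ.2) hR) ?_
    have hEl : E (l + 1) ≤ E a := by
      have : ∀ m, a ≤ m → m ≤ b → E m ≤ E a := by
        intro m hm
        induction m, hm using Nat.le_induction with
        | base => exact fun _ => le_rfl
        | succ m hm ihm => exact fun h => (hE m hm (by omega)).trans (ihm (by omega))
      exact this _ (by omega) (by omega)
    have hcard : ((S.erase p).card : ℝ) + 1 = S.card := by
      exact_mod_cast Finset.card_erase_add_one hp
    rw [← hcard]
    linarith
  · have hR := ih (n - 1) (by omega) S (a + 1) (by omega) hN (fun k hk => hE k (by omega))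
      fun k hk => hstep k (by omega)
    exact hmono (htrans hgood hR) (by linarith)

/-! ### Single steps of the scheme -/

section Scheme

variable {X : Type*} [NormedAddCommGroup X] [InnerProductSpace ℝ X] [FiniteDimensional ℝ X]
  {T : ℝ} {F : ℝ → X → ℝ}

/-- A solution of the minimizing movement scheme with values in the ball of radius `R`. -/
structure IsBoundedScheme (T : ℝ) (F : ℝ → X → ℝ) (R ε τ : ℝ) (v : ℕ → X) : Prop where
  ε_pos : 0 < ε
  τ_pos : 0 < τ
  norm_le : ∀ k ≤ ⌊T / τ⌋₊, ‖v k‖ ≤ R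
  isMinOn : ∀ k : ℕ, k < ⌊T / τ⌋₊ →
    IsMinOn (fun x => F (((k + 1 : ℕ) : ℝ) * τ) x + ε / (2 * τ) * ‖x - v k‖ ^ 2) univ (v (k + 1))

/-- The energy along a discrete solution, corrected by the work bound `M` so as to be
nonincreasing. -/
def discreteEnergy (F : ℝ → X → ℝ) (M τ : ℝ) (v : ℕ → X) (k : ℕ) : ℝ :=
  F (k * τ) (v k) - M * (k * τ)

/-- `M` is a Lipschitz constant in time of the energy on the ball of radius `R`. -/
def TimeLipschitz (T : ℝ) (F : ℝ → X → ℝ) (R M : ℝ) : Prop :=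
  ∀ x : X, ‖x‖ ≤ R → ∀ s ∈ Icc 0 T, ∀ t ∈ Icc 0 T, |F t x - F s x| ≤ M * |t - s|

variable {R M ε τ : ℝ} {v : ℕ → X}

omit [InnerProductSpace ℝ X] [FiniteDimensional ℝ X] in
-- The correction `M τ` absorbs the change of the energy in time at the frozen state `v k`.
theorem IsBoundedScheme.sub_le_discreteEnergy_sub (h : IsBoundedScheme T F R ε τ v) (hT : 0 ≤ T)
    (hM : TimeLipschitz T F R M) {k : ℕ} (hk : k < ⌊T / τ⌋₊) :
    F (((k + 1 : ℕ) : ℝ) * τ) (v k) - F (((k + 1 : ℕ) : ℝ) * τ) (v (k + 1)) ≤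
      discreteEnergy F M τ v k - discreteEnergy F M τ v (k + 1) := by
  have h1 := hM (v k) (h.norm_le k hk.le) _ (mul_mem_Icc_of_le_floor h.τ_pos hT hk.le) _
    (mul_mem_Icc_of_le_floor h.τ_pos hT (Nat.succ_le_of_lt hk))
  have habs : |((k + 1 : ℕ) : ℝ) * τ - k * τ| = ((k + 1 : ℕ) : ℝ) * τ - k * τ := by
    rw [← sub_mul]; push_cast; simp [abs_of_pos h.τ_pos]
  rw [Nat.succ_eq_add_one, habs] at h1
  have := (abs_le.1 h1).2
  simp only [discreteEnergy]
  linarith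

omit [InnerProductSpace ℝ X] [FiniteDimensional ℝ X] in
-- Minimality tested against the competitor `v k`.
theorem IsBoundedScheme.mul_sq_le (h : IsBoundedScheme T F R ε τ v) {k : ℕ}
    (hk : k < ⌊T / τ⌋₊) :
    ε / τ * ‖v (k + 1) - v k‖ ^ 2 ≤
      2 * (F (((k + 1 : ℕ) : ℝ) * τ) (v k) - F (((k + 1 : ℕ) : ℝ) * τ) (v (k + 1))) := by
  have hmin := h.isMinOn k hk (mem_univ (v k))
  simp only [mem_ofPred_eq, sub_self, norm_zero] at hmin
  have : ε / (2 * τ) * ‖v (k + 1) - v k‖ ^ 2 = ε / τ * ‖v (k + 1) - v k‖ ^ 2 / 2 := by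
    field_simp [h.τ_pos.ne']
  norm_num at hmin this ⊢
  linarith

omit [InnerProductSpace ℝ X] [FiniteDimensional ℝ X] in
theorem IsBoundedScheme.discreteEnergy_succ_le (h : IsBoundedScheme T F R ε τ v) (hT : 0 ≤ T)
    (hM : TimeLipschitz T F R M) {k : ℕ} (hk : k < ⌊T / τ⌋₊) :
    discreteEnergy F M τ v (k + 1) ≤ discreteEnergy F M τ v k := by
  have h1 := h.sub_le_discreteEnergy_sub hT hM hk
  have h2 := h.mul_sq_le hk
  have h3 : 0 ≤ ε / τ * ‖v (k + 1) - v k‖ ^ 2 := by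
    have := h.ε_pos; have := h.τ_pos; positivity
  linarith

omit [InnerProductSpace ℝ X] [FiniteDimensional ℝ X] in
theorem IsBoundedScheme.discreteEnergy_le (h : IsBoundedScheme T F R ε τ v) (hT : 0 ≤ T)
    (hM : TimeLipschitz T F R M) {a b : ℕ} (hab : a ≤ b) (hb : b ≤ ⌊T / τ⌋₊) :
    discreteEnergy F M τ v b ≤ discreteEnergy F M τ v a := by
  induction b, hab using Nat.le_induction with
  | base => exact le_rfl
  | succ m _ ih =>
    exact (h.discreteEnergy_succ_le hT hM (Nat.lt_of_succ_le hb)).trans (ih (by omega))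

/-- Euler equation of the minimum problem. -/
theorem IsBoundedScheme.gradX_eq (h : IsBoundedScheme T F R ε τ v) (hT : 0 < T)
    (hF : EnergyAssumptions T F) {k : ℕ} (hk : k < ⌊T / τ⌋₊) :
    gradX F (((k + 1 : ℕ) : ℝ) * τ) (v (k + 1)) = (ε / τ) • (v k - v (k + 1)) := by
  have ht := mul_mem_Icc_of_le_floor h.τ_pos hT.le (Nat.succ_le_of_lt hk)
  have hloc : IsLocalMin _ _ := (h.isMinOn k hk).isLocalMin univ_mem
  have h1 := (hF.hasGradientAt ht (v (k + 1))).hasFDerivAt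
  have h2 : HasFDerivAt (fun x => ε / (2 * τ) * ‖x - v k‖ ^ 2)
      ((ε / (2 * τ)) • (2 • (innerSL ℝ (v (k + 1) - v k)).comp (ContinuousLinearMap.id ℝ X)))
      (v (k + 1)) :=
    (((hasFDerivAt_id (v (k + 1))).sub_const (v k)).norm_sq).const_mul _
  have h3 := hloc.hasFDerivAt_eq_zero (h1.add h2)
  refine ext_inner_right ℝ fun w => ?_
  have h4 := DFunLike.congr_fun h3 w
  simp only [add_apply, InnerProductSpace.toDual_apply_apply,
    smul_apply, ContinuousLinearMap.comp_id, innerSL_apply_apply,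
    zero_apply, smul_eq_mul, nsmul_eq_mul, inner_sub_left] at h4
  rw [inner_smul_left, inner_sub_left]
  have h5 : ε / (2 * τ) = ε / τ / 2 := by field_simp [h.τ_pos.ne']
  rw [h5] at h4
  push_cast at h4 ⊢
  simp only [conj_trivial] at h4 ⊢
  linarith

theorem IsBoundedScheme.norm_gradX_eq (h : IsBoundedScheme T F R ε τ v) (hT : 0 < T)
    (hF : EnergyAssumptions T F) {k : ℕ} (hk : k < ⌊T / τ⌋₊) :
    ‖gradX F (((k + 1 : ℕ) : ℝ) * τ) (v (k + 1))‖ = ε / τ * ‖v (k + 1) - v k‖ := by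
  rw [h.gradX_eq hT hF hk, norm_smul, norm_sub_rev,
    Real.norm_of_nonneg (div_pos h.ε_pos h.τ_pos).le]

/-- Minimality alone loses a factor 2. This is enough to control lengths, but not for the sharp
cost. -/
theorem IsBoundedScheme.norm_mul_norm_gradX_le (h : IsBoundedScheme T F R ε τ v) (hT : 0 < T)
    (hF : EnergyAssumptions T F) (hM : TimeLipschitz T F R M) {k : ℕ} (hk : k < ⌊T / τ⌋₊) :
    ‖v (k + 1) - v k‖ * ‖gradX F (((k + 1 : ℕ) : ℝ) * τ) (v (k + 1))‖ ≤
      2 * (discreteEnergy F M τ v k - discreteEnergy F M τ v (k + 1)) := by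
  have h1 := h.sub_le_discreteEnergy_sub hT.le hM hk
  have h2 := h.mul_sq_le hk
  rw [h.norm_gradX_eq hT hF hk]
  linarith

/-- If the gradient oscillates by at most `ω` on the segment of a step, the energy released by
the step is almost the length of the step times the slope at its end. -/
theorem IsBoundedScheme.norm_mul_norm_gradX_le_add (h : IsBoundedScheme T F R ε τ v) (hT : 0 < T)
    (hF : EnergyAssumptions T F) (hM : TimeLipschitz T F R M) {k : ℕ} (hk : k < ⌊T / τ⌋₊)
    {ω : ℝ} (hω : ∀ z ∈ segment ℝ (v k) (v (k + 1)),
      ‖gradX F (((k + 1 : ℕ) : ℝ) * τ) z -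
        gradX F (((k + 1 : ℕ) : ℝ) * τ) (v (k + 1))‖ ≤ ω) :
    ‖v (k + 1) - v k‖ * ‖gradX F (((k + 1 : ℕ) : ℝ) * τ) (v (k + 1))‖ ≤
      discreteEnergy F M τ v k - discreteEnergy F M τ v (k + 1) + ω * ‖v (k + 1) - v k‖ := by
  have ht := mul_mem_Icc_of_le_floor h.τ_pos hT.le (Nat.succ_le_of_lt hk)
  have h1 := h.sub_le_discreteEnergy_sub hT.le hM hk
  have h2 := Convex.norm_image_sub_le_of_norm_hasFDerivWithin_le'
    (fun z (_ : z ∈ segment ℝ (v k) (v (k + 1))) =>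
      (hF.hasGradientAt ht z).hasFDerivAt.hasFDerivWithinAt)
    (φ := InnerProductSpace.toDual ℝ X (gradX F (((k + 1 : ℕ) : ℝ) * τ) (v (k + 1)))) (C := ω)
    (fun z hz => by rw [← map_sub, LinearIsometryEquiv.norm_map]; exact hω z hz)
    (convex_segment _ _) (right_mem_segment ℝ (v k) (v (k + 1)))
    (left_mem_segment ℝ (v k) (v (k + 1)))
  have h3 : inner ℝ (gradX F (((k + 1 : ℕ) : ℝ) * τ) (v (k + 1))) (v k - v (k + 1)) =
      ‖v (k + 1) - v k‖ * ‖gradX F (((k + 1 : ℕ) : ℝ) * τ) (v (k + 1))‖ := by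
    rw [h.norm_gradX_eq hT hF hk, h.gradX_eq hT hF hk, inner_smul_left,
      real_inner_self_eq_norm_sq, norm_sub_rev]
    simp only [conj_trivial]
    ring
  rw [InnerProductSpace.toDual_apply_apply, Nat.succ_eq_add_one, h3, Real.norm_eq_abs,
    norm_sub_rev (v k)] at h2
  have := (abs_le.1 h2).1
  linarith

/-- Near time `t`, a step either stays close to a critical point, or it is quasi-optimal. -/
theorem EnergyAssumptions.exists_step_alternative (hT : 0 < T) (hF : EnergyAssumptions T F)
    (hM : TimeLipschitz T F R M) {t : ℝ} (ht : t ∈ Icc 0 T) {r : ℝ} (hr : 0 < r) :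
    ∃ η > 0, ∀ ω > 0, ∃ δ > 0, ∃ Λ : ℝ, ∀ {ε τ : ℝ} {v : ℕ → X},
      IsBoundedScheme T F R ε τ v → Λ ≤ ε / τ → ∀ k < ⌊T / τ⌋₊,
      |((k + 1 : ℕ) : ℝ) * τ - t| ≤ δ →
      (∃ p ∈ criticalSet F t ∩ Metric.closedBall 0 R,
        v k ∈ Metric.closedBall p (2 * r) ∧ v (k + 1) ∈ Metric.closedBall p (2 * r)) ∨
      (η * ‖v (k + 1) - v k‖ ≤ discreteEnergy F M τ v k - discreteEnergy F M τ v (k + 1) ∧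
        ∀ z ∈ segment ℝ (v k) (v (k + 1)), ‖v (k + 1) - v k‖ * ‖gradX F t z‖ ≤
          discreteEnergy F M τ v k - discreteEnergy F M τ v (k + 1)
            + ω * ‖v (k + 1) - v k‖) := by
  set S := criticalSet F t ∩ Metric.closedBall (0 : X) R with hS
  have hcont := hF.continuous_gradX hT ht
  -- Away from the critical points, compactness bounds the slope below by some `m > 0`.
  set A := Metric.closedBall (0 : X) R ∩ {x | ∀ p ∈ S, r ≤ dist x p} with hA
  have hAc : IsCompact A := by
    refine (isCompact_closedBall (0 : X) R).inter_right ?_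
    simp only [ofPred_forall]
    exact isClosed_biInter fun p _ => isClosed_le continuous_const (by fun_prop)
  obtain ⟨m, hm, hmA⟩ : ∃ m > 0, ∀ x ∈ A, m ≤ ‖gradX F t x‖ := by
    rcases A.eq_empty_or_nonempty with h | h
    · exact ⟨1, one_pos, by simp [h]⟩
    · obtain ⟨x, hx, hmin⟩ := hAc.exists_isMinOn h hcont.norm.continuousOn
      refine ⟨‖gradX F t x‖, norm_pos_iff.2 fun h0 => ?_, fun y hy => hmin hy⟩
      have := hx.2 x ⟨h0, hx.1⟩
      rw [dist_self] at this
      linarith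
  have hK : IsCompact (Icc 0 T ×ˢ Metric.closedBall (0 : X) R) :=
    isCompact_Icc.prod (isCompact_closedBall _ _)
  have hcK : ContinuousOn (fun p : ℝ × X => gradX F p.1 p.2)
      (Icc 0 T ×ˢ Metric.closedBall (0 : X) R) :=
    (hF.continuousOn_gradX hT).mono (prod_mono Subset.rfl (subset_univ _))
  obtain ⟨B, hB⟩ := hK.exists_bound_of_continuousOn hcK
  have huc := hK.uniformContinuousOn_of_continuous hcK
  rw [Metric.uniformContinuousOn_iff] at huc
  -- The slope at the actual grid time is at least `m / 2`, and minimality loses a factor 2. This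
  -- value is fixed before `ω`, so `ω` may later be chosen proportional to it.
  refine ⟨m / 4, by positivity, fun ω hω => ?_⟩
  -- The oscillation of the gradient enters twice: along the segment at the grid time, and in
  -- passing to time `t`.
  set ω' := min (ω / 2) (m / 2) with hω'
  obtain ⟨δ, hδ, hδu⟩ := huc ω' (by positivity)
  have hm0 : 0 < min (δ / 2) r := by positivity
  -- Gradients are bounded by `B`, so by the Euler equation this threshold on `ε / τ` makes steps no
  -- longer than `min (δ / 2) r`.
  refine ⟨δ / 2, by positivity, (max B 0 + 1) / min (δ / 2) r, ?_⟩
  intro ε τ v h hΛ k hk hkt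
  set s := ((k + 1 : ℕ) : ℝ) * τ with hs
  have hsT : s ∈ Icc 0 T := mul_mem_Icc_of_le_floor h.τ_pos hT.le (Nat.succ_le_of_lt hk)
  have hy : v (k + 1) ∈ Metric.closedBall (0 : X) R := by
    simpa using h.norm_le (k + 1) hk
  have hx : v k ∈ Metric.closedBall (0 : X) R := by simpa using h.norm_le k hk.le
  have hΔ : ‖v (k + 1) - v k‖ ≤ min (δ / 2) r := by
    have h1 := h.norm_gradX_eq hT hF hk
    have h2 := hB (s, v (k + 1)) ⟨hsT, hy⟩
    simp only at h2
    rw [h1] at h2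
    have h3 : (max B 0 + 1) / min (δ / 2) r * ‖v (k + 1) - v k‖ ≤ max B 0 + 1 :=
      (mul_le_mul_of_nonneg_right hΛ (norm_nonneg _)).trans
        (h2.trans ((le_max_left B 0).trans (by linarith)))
    rw [div_mul_eq_mul_div, div_le_iff₀ hm0] at h3
    exact le_of_mul_le_mul_left h3 (by positivity)
  have hΔδ := hΔ.trans (min_le_left _ _)
  have hΔr := hΔ.trans (min_le_right _ _)
  by_cases hyA : v (k + 1) ∈ A
  · right
    have hseg : ∀ z ∈ segment ℝ (v k) (v (k + 1)), z ∈ Metric.closedBall (0 : X) R ∧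
        dist z (v (k + 1)) ≤ δ / 2 := fun z hz => by
      refine ⟨(convex_closedBall (0 : X) R).segment_subset hx hy hz, ?_⟩
      have : z ∈ Metric.closedBall (v (k + 1)) (δ / 2) :=
        (convex_closedBall (v (k + 1)) (δ / 2)).segment_subset
          (by rw [Metric.mem_closedBall, dist_comm, dist_eq_norm]; exact hΔδ)
          (Metric.mem_closedBall_self (by positivity)) hz
      exact this
    have hosc : ∀ r ∈ Icc 0 T, |r - s| ≤ δ / 2 → ∀ z ∈ segment ℝ (v k) (v (k + 1)),
        ‖gradX F r z - gradX F s (v (k + 1))‖ ≤ ω' := fun r hr hrs z hz => by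
      rw [← dist_eq_norm]
      refine (hδu (r, z) ⟨hr, (hseg z hz).1⟩ (s, v (k + 1)) ⟨hsT, hy⟩ ?_).le
      rw [Prod.dist_eq, Real.dist_eq]
      exact max_lt (hrs.trans_lt (by linarith)) ((hseg z hz).2.trans_lt (by linarith))
    have hts : |t - s| ≤ δ / 2 := by rwa [abs_sub_comm]
    have hslope := hmA _ hyA
    have hslope' : m / 2 ≤ ‖gradX F s (v (k + 1))‖ := by
      have h1 := (norm_sub_norm_le _ _).trans (hosc t ht hts _ (right_mem_segment ℝ _ _))
      linarith [min_le_right (ω / 2) (m / 2)]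
    constructor
    · have h1 := h.norm_mul_norm_gradX_le hT hF hM hk
      have h2 := mul_le_mul_of_nonneg_left hslope' (norm_nonneg (v (k + 1) - v k))
      linarith
    · intro z hz
      have h1 := h.norm_mul_norm_gradX_le_add hT hF hM hk
        (hosc s hsT (by rw [sub_self, abs_zero]; positivity))
      have h2 := (norm_sub_norm_le _ _).trans (hosc t ht hts z hz)
      have h3 : ‖gradX F t z‖ ≤ ‖gradX F s (v (k + 1))‖ + ω' := by linarith
      have h4 := mul_le_mul_of_nonneg_left h3 (norm_nonneg (v (k + 1) - v k))
      have h5 := mul_le_mul_of_nonneg_right (min_le_left (ω / 2) (m / 2))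
        (norm_nonneg (v (k + 1) - v k))
      linarith
  · left
    have : ∃ p ∈ S, dist (v (k + 1)) p < r := by
      by_contra! hcon
      exact hyA ⟨hy, hcon⟩
    obtain ⟨p, hp, hpr⟩ := this
    refine ⟨p, hp, ?_, ?_⟩
    · rw [Metric.mem_closedBall]
      have := dist_triangle (v k) (v (k + 1)) p
      rw [dist_comm (v k) (v (k + 1)), dist_eq_norm (v (k + 1)) (v k)] at this
      linarith
    · rw [Metric.mem_closedBall]
      linarith

/-! ### Chains of steps near a fixed time -/

/-- Otherwise critical points would accumulate in the compact ball; the critical set is closed, so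
the accumulation point would be a non-isolated critical point. -/
theorem EnergyAssumptions.finite_criticalSet_inter (hT : 0 < T) (hF : EnergyAssumptions T F)
    {t : ℝ} (ht : t ∈ Icc 0 T) (R : ℝ) :
    (criticalSet F t ∩ Metric.closedBall 0 R).Finite := by
  by_contra hinf
  obtain ⟨x, -, hx⟩ := Set.Infinite.exists_accPt_of_subset_isCompact hinf
    (isCompact_closedBall (0 : X) R) inter_subset_right
  have hcl : IsClosed (criticalSet F t) :=
    isClosed_eq (hF.continuous_gradX hT ht) continuous_const
  have hx' : AccPt x (𝓟 (criticalSet F t)) := hx.mono (principal_mono.2 inter_subset_left)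
  have hmem : x ∈ criticalSet F t := hcl.closure_subset hx'.clusterPt.mem_closure
  obtain ⟨y, hy, hy'⟩ :=
    ((accPt_iff_frequently_nhdsNE.1 hx').and_eventually (hF.isolated t ht x hmem)).exists
  exact hy' hy

/-- Near time `t`, a small release of energy forces a small displacement. -/
theorem EnergyAssumptions.exists_dist_le (hT : 0 < T) (hF : EnergyAssumptions T F)
    (hM : TimeLipschitz T F R M) {t : ℝ} (ht : t ∈ Icc 0 T) {ρ : ℝ} (hρ : 0 < ρ) :
    ∃ δ > 0, ∃ Λ : ℝ, ∀ {ε τ : ℝ} {v : ℕ → X}, IsBoundedScheme T F R ε τ v → Λ ≤ ε / τ →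
      ∀ a b : ℕ, a ≤ b → b ≤ ⌊T / τ⌋₊ → |a * τ - t| ≤ δ → |b * τ - t| ≤ δ →
      discreteEnergy F M τ v a - discreteEnergy F M τ v b ≤ δ → dist (v a) (v b) ≤ ρ := by
  classical
  set S := (hF.finite_criticalSet_inter hT ht R).toFinset with hS
  -- Each excised ball has diameter at most `4 r`; together they cost at most `ρ / 2`, leaving `ρ /
  -- 2` for the other steps.
  set r : ℝ := ρ / (8 * (S.card + 1)) with hr
  have hr0 : 0 < r := by positivity
  obtain ⟨η, hη, h1⟩ := hF.exists_step_alternative hT hM ht hr0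
  obtain ⟨δ, hδ, Λ, h2⟩ := h1 1 one_pos
  refine ⟨min δ (η * (ρ / 2)), by positivity, Λ, ?_⟩
  intro ε τ v h hΛ a b hab hb ha' hb' hE
  have h3 := rel_of_steps (R := fun x y c => dist x y ≤ c) (fun x => (dist_self x).le)
    (fun h hcd => h.trans hcd) (fun h1 h2 => (dist_triangle _ _ _).trans (add_le_add h1 h2))
    (x := v) (E := fun k => discreteEnergy F M τ v k / η)
    (N := fun p => Metric.closedBall p (2 * r)) (σ := 4 * r) (by positivity) (b := b) (b - a)
    S a (by omega)
    (fun p _ y hy z hz => by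
      rw [Metric.mem_closedBall] at hy hz
      linarith [dist_triangle_right y z p])
    (fun k hk hkb => by
      have := h.discreteEnergy_succ_le hT.le hM (k := k) (by omega)
      gcongr)
    (fun k hk hkb => by
      have hτ := h.τ_pos
      have hk1 : (a : ℝ) * τ ≤ ((k + 1 : ℕ) : ℝ) * τ := by gcongr; omega
      have hk2 : ((k + 1 : ℕ) : ℝ) * τ ≤ b * τ := by gcongr; omega
      have ha'' := abs_le.1 (ha'.trans (min_le_left _ _))
      have hb'' := abs_le.1 (hb'.trans (min_le_left _ _))
      refine (h2 h hΛ k (by omega) (abs_le.2 ⟨by linarith, by linarith⟩)).imp ?_ ?_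
      · rintro ⟨p, hp, hpk⟩
        exact ⟨p, (hF.finite_criticalSet_inter hT ht R).mem_toFinset.2 hp, hpk⟩
      · rintro ⟨hd, -⟩
        rw [dist_comm, dist_eq_norm, ← sub_div, le_div_iff₀ hη]
        linarith)
  rw [← sub_div] at h3
  have h4 : (discreteEnergy F M τ v a - discreteEnergy F M τ v b) / η ≤ ρ / 2 := by
    rw [div_le_iff₀ hη, mul_comm]
    exact hE.trans (min_le_right _ _)
  have h5 : S.card * (4 * r) ≤ ρ / 2 := by
    rw [hr, mul_div_assoc', mul_div_assoc', div_le_iff₀ (by positivity)]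
    nlinarith
  linarith

/-- Near time `t`, the states of a discrete solution are joined by curves whose cost is at most
the released energy, up to a small error. -/
theorem EnergyAssumptions.exists_lipschitzCost (hT : 0 < T) (hF : EnergyAssumptions T F)
    (hM : TimeLipschitz T F R M) {t : ℝ} (ht : t ∈ Icc 0 T) {κ : ℝ} (hκ : 0 < κ) :
    ∃ δ > 0, ∃ Λ : ℝ, ∀ {ε τ : ℝ} {v : ℕ → X}, IsBoundedScheme T F R ε τ v → Λ ≤ ε / τ →
      ∀ a b : ℕ, a ≤ b → b ≤ ⌊T / τ⌋₊ → |a * τ - t| ≤ δ → |b * τ - t| ≤ δ →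
      LipschitzCost (fun z => ‖gradX F t z‖) (v b) (v a)
        ((1 + κ) * (discreteEnergy F M τ v a - discreteEnergy F M τ v b) + κ) := by
  classical
  set S := (hF.finite_criticalSet_inter hT ht R).toFinset with hS
  have hcont := (hF.continuous_gradX hT ht).norm
  -- Balls of radius `2 r ≤ 2` around critical points of norm at most `R` stay in this larger ball.
  obtain ⟨B, hB⟩ := (isCompact_closedBall (0 : X) (R + 2)).exists_bound_of_continuousOn
    (hF.continuous_gradX hT ht).continuousOn
  set B' := max B 0 with hB'
  have hB0 : 0 ≤ B' := le_max_right _ _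
  set r : ℝ := min 1 (κ / (4 * (B' + 1) * (S.card + 1))) with hr
  have hr0 : 0 < r := by positivity
  obtain ⟨η, hη, h1⟩ := hF.exists_step_alternative hT hM ht hr0
  -- With `ω = κ η` the error `ω ‖v (k + 1) - v k‖` is at most `κ` times the released energy, whence
  -- the factor `1 + κ`.
  obtain ⟨δ, hδ, Λ, h2⟩ := h1 (κ * η) (by positivity)
  refine ⟨δ, hδ, Λ, ?_⟩
  intro ε τ v h hΛ a b hab hb ha' hb'
  -- Curves run backward, from the later state to the earlier one, as in the cost of the jump.
  have h3 := rel_of_steps (R := fun x y c => LipschitzCost (fun z => ‖gradX F t z‖) y x c)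
    (fun x => lipschitzCost_of_segment (fun z => norm_nonneg _) fun z _ => by simp)
    (fun h hcd => h.mono hcd)
    (fun {x y z c d} h1 h2 => (h2.trans hcont h1).mono (add_comm d c).le)
    (x := v) (E := fun k => (1 + κ) * discreteEnergy F M τ v k)
    (N := fun p => Metric.closedBall p (2 * r)) (σ := 4 * r * B') (by positivity) (b := b) (b - a)
    S a (by omega)
    (fun p hp y hy z hz => by
      have hpR := ((hF.finite_criticalSet_inter hT ht R).mem_toFinset.1 hp).2
      refine lipschitzCost_of_segment (fun z => norm_nonneg _) fun w hw => ?_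
      have hwp := (convex_closedBall p (2 * r)).segment_subset hz hy hw
      rw [Metric.mem_closedBall] at hy hz hwp hpR
      have hwR : w ∈ Metric.closedBall (0 : X) (R + 2) := by
        rw [Metric.mem_closedBall]
        linarith [dist_triangle w p 0, min_le_left 1 (κ / (4 * (B' + 1) * (S.card + 1)))]
      rw [← dist_eq_norm]
      refine mul_le_mul ?_ ((hB w hwR).trans (le_max_left _ _)) (norm_nonneg _) (by positivity)
      linarith [dist_triangle_right y z p])
    (fun k hk hkb => by
      have := h.discreteEnergy_succ_le hT.le hM (k := k) (by omega)
      gcongr)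
    (fun k hk hkb => by
      have hτ := h.τ_pos
      have hk1 : (a : ℝ) * τ ≤ ((k + 1 : ℕ) : ℝ) * τ := by gcongr; omega
      have hk2 : ((k + 1 : ℕ) : ℝ) * τ ≤ b * τ := by gcongr; omega
      have ha'' := abs_le.1 ha'
      have hb'' := abs_le.1 hb'
      refine (h2 h hΛ k (by omega) (abs_le.2 ⟨by linarith, by linarith⟩)).imp ?_ ?_
      · rintro ⟨p, hp, hpk⟩
        exact ⟨p, (hF.finite_criticalSet_inter hT ht R).mem_toFinset.2 hp, hpk⟩
      · rintro ⟨hd, hz⟩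
        refine lipschitzCost_of_segment (fun z => norm_nonneg _) fun w hw => ?_
        rw [segment_symm] at hw
        have hw' := hz w hw
        have hd' := mul_le_mul_of_nonneg_left hd hκ.le
        rw [norm_sub_rev]
        linarith)
  refine h3.mono ?_
  have h5 : S.card * (4 * r * B') ≤ κ := by
    have h6 : r * (4 * (B' + 1) * (S.card + 1)) ≤ κ :=
      (le_div_iff₀ (by positivity)).1 (min_le_right _ _)
    have h7 : (S.card : ℝ) * (4 * r * B') ≤ (S.card + 1) * (4 * r * (B' + 1)) := by
      gcongr <;> linarith
    linarith
  linarith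

end Scheme

/-! ### Interpolants -/

section Interpolant

/-- The index of the discrete state that the interpolant takes at time `t`. -/
noncomputable def stepIndex (T τ t : ℝ) : ℕ := min ⌈t / τ⌉₊ ⌊T / τ⌋₊

theorem stepIndex_le (T τ t : ℝ) : stepIndex T τ t ≤ ⌊T / τ⌋₊ := min_le_right _ _

theorem stepIndex_mono {T τ : ℝ} (hτ : 0 < τ) : Monotone (stepIndex T τ) := fun s t hst =>
  min_le_min_right _ (Nat.ceil_mono (by gcongr))

theorem abs_stepIndex_mul_sub_le {T τ t : ℝ} (hτ : 0 < τ) (ht : t ∈ Icc 0 T) :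
    |stepIndex T τ t * τ - t| ≤ τ := by
  have h0 : 0 ≤ t / τ := div_nonneg ht.1 hτ.le
  rcases le_total ⌈t / τ⌉₊ ⌊T / τ⌋₊ with h | h
  · rw [stepIndex, min_eq_left h]
    have h1 := (div_le_iff₀ hτ).1 (Nat.le_ceil (t / τ))
    have h2 := Nat.ceil_lt_add_one h0
    rw [← sub_lt_iff_lt_add, lt_div_iff₀ hτ] at h2
    exact abs_le.2 ⟨by linarith, by linarith⟩
  · rw [stepIndex, min_eq_right h]
    have h1 := Nat.lt_floor_add_one (T / τ)
    rw [div_lt_iff₀ hτ] at h1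
    have h2 : (⌊T / τ⌋₊ : ℝ) ≤ t / τ + 1 :=
      (Nat.cast_le.2 h).trans (Nat.ceil_lt_add_one h0).le
    rw [← sub_le_iff_le_add, le_div_iff₀ hτ] at h2
    exact abs_le.2 ⟨by linarith [ht.2], by linarith⟩

/-- Sequential compactness of a countable product replaces a diagonal extraction. -/
theorem exists_strictMono_tendsto_of_countable {α X : Type*} [PseudoMetricSpace X] {K : Set X}
    (hK : IsCompact K) {f : ℕ → α → X} (hf : ∀ j t, f j t ∈ K) {C : Set α} (hC : C.Countable) :
    ∃ φ : ℕ → ℕ, StrictMono φ ∧ ∀ t ∈ C, ∃ x, Tendsto (fun j => f (φ j) t) atTop (𝓝 x) := by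
  have := hC.to_subtype
  obtain ⟨x, -, φ, hφ, hx⟩ := (isCompact_univ_pi fun _ : C => hK).tendsto_subseq
    (x := fun j (t : C) => f j t) fun j t _ => hf j t
  exact ⟨φ, hφ, fun t ht => ⟨x ⟨t, ht⟩, tendsto_pi_nhds.1 hx ⟨t, ht⟩⟩⟩

end Interpolant

/-! ### Limits of the interpolants -/

section Limit

variable {X : Type*} [NormedAddCommGroup X] [InnerProductSpace ℝ X] [FiniteDimensional ℝ X]
  {T : ℝ} {F : ℝ → X → ℝ}

/-- A sequence of bounded discrete solutions with vanishing time step and with viscosity large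
with respect to the time step. -/
structure IsSchemeSequence (T : ℝ) (F : ℝ → X → ℝ) (R : ℝ) (ε τ : ℕ → ℝ) (v : ℕ → ℕ → X) :
    Prop where
  scheme : ∀ j, IsBoundedScheme T F R (ε j) (τ j) (v j)
  tendsto_τ : Tendsto τ atTop (𝓝 0)
  tendsto_ratio : Tendsto (fun j => ε j / τ j) atTop atTop

/-- The corrected energy along the interpolant. -/
noncomputable def interpEnergy (T : ℝ) (F : ℝ → X → ℝ) (M τ : ℝ) (v : ℕ → X) (t : ℝ) : ℝ :=
  discreteEnergy F M τ v (stepIndex T τ t)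

variable {R M : ℝ} {ε τ : ℕ → ℝ} {v : ℕ → ℕ → X}

omit [InnerProductSpace ℝ X] [FiniteDimensional ℝ X] in
theorem IsSchemeSequence.comp (h : IsSchemeSequence T F R ε τ v) {φ : ℕ → ℕ}
    (hφ : StrictMono φ) : IsSchemeSequence T F R (ε ∘ φ) (τ ∘ φ) (v ∘ φ) :=
  ⟨fun j => h.scheme (φ j), h.tendsto_τ.comp hφ.tendsto_atTop,
    h.tendsto_ratio.comp hφ.tendsto_atTop⟩

omit [InnerProductSpace ℝ X] [FiniteDimensional ℝ X] in
theorem IsSchemeSequence.norm_interpolant_le (h : IsSchemeSequence T F R ε τ v) (j : ℕ) (t : ℝ) :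
    ‖interpolant T (τ j) (v j) t‖ ≤ R :=
  (h.scheme j).norm_le _ (stepIndex_le _ _ _)

omit [InnerProductSpace ℝ X] [FiniteDimensional ℝ X] in
theorem IsSchemeSequence.antitone_interpEnergy (h : IsSchemeSequence T F R ε τ v) (hT : 0 ≤ T)
    (hM : TimeLipschitz T F R M) (j : ℕ) : Antitone (interpEnergy T F M (τ j) (v j)) :=
  fun _ _ hst => (h.scheme j).discreteEnergy_le hT hM
    (stepIndex_mono (h.scheme j).τ_pos hst) (stepIndex_le _ _ _)

theorem IsSchemeSequence.exists_abs_interpEnergy_le (h : IsSchemeSequence T F R ε τ v)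
    (hT : 0 ≤ T) (hF : EnergyAssumptions T F) :
    ∃ B, ∀ j t, |interpEnergy T F M (τ j) (v j) t| ≤ B := by
  have hK : IsCompact (Icc 0 T ×ˢ Metric.closedBall (0 : X) R) :=
    isCompact_Icc.prod (isCompact_closedBall _ _)
  have hc : ContinuousOn (fun p : ℝ × X => F p.1 p.2 - M * p.1)
      (Icc 0 T ×ˢ Metric.closedBall (0 : X) R) :=
    (hF.continuousOn.mono (prod_mono Subset.rfl (subset_univ _))).sub (by fun_prop)
  obtain ⟨B, hB⟩ := hK.exists_bound_of_continuousOn hc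
  refine ⟨B, fun j t => hB (stepIndex T (τ j) t * τ j, v j (stepIndex T (τ j) t)) ⟨?_, ?_⟩⟩
  · exact mul_mem_Icc_of_le_floor (h.scheme j).τ_pos hT (stepIndex_le _ _ _)
  · simpa using (h.scheme j).norm_le _ (stepIndex_le T (τ j) t)

theorem IsSchemeSequence.exists_dist_interpolant_le (h : IsSchemeSequence T F R ε τ v)
    (hT : 0 < T) (hF : EnergyAssumptions T F) (hM : TimeLipschitz T F R M) {t : ℝ}
    (ht : t ∈ Icc 0 T) {ρ : ℝ} (hρ : 0 < ρ) :
    ∃ δ > 0, ∀ᶠ j in atTop, ∀ s ∈ Icc 0 T, ∀ s' ∈ Icc 0 T, s ≤ s' → |s - t| ≤ δ → |s' - t| ≤ δ →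
      interpEnergy T F M (τ j) (v j) s - interpEnergy T F M (τ j) (v j) s' ≤ δ →
      dist (interpolant T (τ j) (v j) s) (interpolant T (τ j) (v j) s') ≤ ρ := by
  obtain ⟨δ, hδ, Λ, hd⟩ := hF.exists_dist_le hT hM ht hρ
  -- The other half of `δ` absorbs the gap between a time and the grid time of its state, at most `τ
  -- j`.
  refine ⟨δ / 2, by positivity, ?_⟩
  filter_upwards [h.tendsto_ratio.eventually_ge_atTop Λ,
    h.tendsto_τ.eventually (ge_mem_nhds (half_pos hδ))] with j hΛ hτ s hs s' hs' hss hst hst' hE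
  have hτ0 := (h.scheme j).τ_pos
  have h1 := abs_stepIndex_mul_sub_le hτ0 hs
  have h2 := abs_stepIndex_mul_sub_le hτ0 hs'
  refine hd (h.scheme j) hΛ _ _ (stepIndex_mono hτ0 hss) (stepIndex_le _ _ _) ?_ ?_
    (hE.trans (by linarith))
  · exact (abs_sub_le _ s t).trans ((add_le_add h1 hst).trans (by linarith))
  · exact (abs_sub_le _ s' t).trans ((add_le_add h2 hst').trans (by linarith))

theorem IsSchemeSequence.exists_lipschitzCost_interpolant (h : IsSchemeSequence T F R ε τ v)
    (hT : 0 < T) (hF : EnergyAssumptions T F) (hM : TimeLipschitz T F R M) {t : ℝ}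
    (ht : t ∈ Icc 0 T) {κ : ℝ} (hκ : 0 < κ) :
    ∃ δ > 0, ∀ᶠ j in atTop, ∀ s ∈ Icc 0 T, ∀ s' ∈ Icc 0 T, s ≤ s' → |s - t| ≤ δ → |s' - t| ≤ δ →
      LipschitzCost (fun z => ‖gradX F t z‖) (interpolant T (τ j) (v j) s')
        (interpolant T (τ j) (v j) s) ((1 + κ) *
          (interpEnergy T F M (τ j) (v j) s - interpEnergy T F M (τ j) (v j) s') + κ) := by
  obtain ⟨δ, hδ, Λ, hd⟩ := hF.exists_lipschitzCost hT hM ht hκ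
  refine ⟨δ / 2, by positivity, ?_⟩
  filter_upwards [h.tendsto_ratio.eventually_ge_atTop Λ,
    h.tendsto_τ.eventually (ge_mem_nhds (half_pos hδ))] with j hΛ hτ s hs s' hs' hss hst hst'
  have hτ0 := (h.scheme j).τ_pos
  have h1 := abs_stepIndex_mul_sub_le hτ0 hs
  have h2 := abs_stepIndex_mul_sub_le hτ0 hs'
  refine hd (h.scheme j) hΛ _ _ (stepIndex_mono hτ0 hss) (stepIndex_le _ _ _) ?_ ?_
  · exact (abs_sub_le _ s t).trans ((add_le_add h1 hst).trans (by linarith))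
  · exact (abs_sub_le _ s' t).trans ((add_le_add h2 hst').trans (by linarith))

theorem EnergyAssumptions.tendsto_comp (hF : EnergyAssumptions T F) {α : Type*} {l : Filter α}
    {s : α → ℝ} {x : α → X} {t : ℝ} {y : X} (ht : t ∈ Icc 0 T) (hs : Tendsto s l (𝓝 t))
    (hsT : ∀ᶠ a in l, s a ∈ Icc 0 T) (hx : Tendsto x l (𝓝 y)) :
    Tendsto (fun a => F (s a) (x a) - M * s a) l (𝓝 (F t y - M * t)) := by
  have h1 : Tendsto (fun a => (s a, x a)) l (𝓝[Icc 0 T ×ˢ univ] (t, y)) :=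
    tendsto_nhdsWithin_iff.2 ⟨hs.prodMk_nhds hx, hsT.mono fun a ha => ⟨ha, mem_univ _⟩⟩
  have h2 : Tendsto (fun a => F (s a) (x a)) l (𝓝 (F t y)) :=
    (hF.continuousOn (t, y) ⟨ht, mem_univ _⟩).tendsto.comp h1
  exact h2.sub (hs.const_mul M)

theorem IsSchemeSequence.tendsto_interpEnergy (h : IsSchemeSequence T F R ε τ v)
    (hF : EnergyAssumptions T F) {t : ℝ} (ht : t ∈ Icc 0 T) {y : X}
    (hy : Tendsto (fun j => interpolant T (τ j) (v j) t) atTop (𝓝 y)) :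
    Tendsto (fun j => interpEnergy T F M (τ j) (v j) t) atTop (𝓝 (F t y - M * t)) := by
  refine hF.tendsto_comp ht ?_ (Eventually.of_forall fun j => ?_) hy
  · refine tendsto_iff_dist_tendsto_zero.2 (squeeze_zero (fun _ => dist_nonneg) (fun j => ?_)
      h.tendsto_τ)
    exact abs_stepIndex_mul_sub_le (h.scheme j).τ_pos ht
  · exact mul_mem_Icc_of_le_floor (h.scheme j).τ_pos (ht.1.trans ht.2) (stepIndex_le _ _ _)

/-- **Compactness**: a subsequence of the interpolants converges pointwise. -/
theorem IsSchemeSequence.exists_subseq_tendsto (h : IsSchemeSequence T F R ε τ v)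
    (hT : 0 < T) (hF : EnergyAssumptions T F) (hM : TimeLipschitz T F R M) :
    ∃ φ : ℕ → ℕ, StrictMono φ ∧ ∀ t ∈ Icc 0 T, ∃ x,
      Tendsto (fun j => interpolant T (τ (φ j)) (v (φ j)) t) atTop (𝓝 x) := by
  have hmem : ∀ j t, interpolant T (τ j) (v j) t ∈ Metric.closedBall (0 : X) R := fun j t => by
    simpa using h.norm_interpolant_le j t
  obtain ⟨φ, hφ, hφc⟩ := exists_strictMono_tendsto_of_countable
    (isCompact_closedBall (0 : X) R) hmem (countable_range ((↑) : ℚ → ℝ))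
  have h' := h.comp hφ
  obtain ⟨B, hB⟩ := h'.exists_abs_interpEnergy_le (M := M) hT.le hF
  set E : ℕ → ℝ → ℝ := fun j => interpEnergy T F M ((τ ∘ φ) j) ((v ∘ φ) j) with hE
  have hbdd : ∀ t, IsBoundedUnder (· ≤ ·) atTop (fun j => E j t) := fun t =>
    isBoundedUnder_of ⟨B, fun j => (abs_le.1 (hB j t)).2⟩
  have hbdd' : ∀ t, IsBoundedUnder (· ≥ ·) atTop (fun j => E j t) := fun t =>
    isBoundedUnder_of ⟨-B, fun j => (abs_le.1 (hB j t)).1⟩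
  -- The upper limit is monotone without further extraction; only at rational times in `[0, T]` is
  -- it known to be a limit.
  set H : ℝ → ℝ := fun t => limsup (fun j => E j t) atTop with hH
  have hanti : Antitone H := fun s t hst =>
    limsup_le_limsup (Eventually.of_forall fun j => h'.antitone_interpEnergy hT.le hM j hst)
      (hbdd' t).isCoboundedUnder_le (hbdd s)
  have hHlim : ∀ q : ℚ, (q : ℝ) ∈ Icc 0 T → Tendsto (fun j => E j q) atTop (𝓝 (H q)) := by
    intro q hq
    obtain ⟨x, hx⟩ := hφc q (mem_range_self q)
    have := h'.tendsto_interpEnergy (M := M) hF hq hx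
    rwa [← this.limsup_eq] at this
  -- Times that cannot be squeezed between rationals with close energies: they are countable, and a
  -- second extraction handles them.
  set D : Set ℝ := {t | ¬ContinuousAt H t} ∪ {0, T} with hD
  have hDc : D.Countable := hanti.countable_not_continuousAt.union (countable_insert.2
    (countable_singleton T))
  obtain ⟨ψ, hψ, hψc⟩ := exists_strictMono_tendsto_of_countable
    (isCompact_closedBall (0 : X) R) (fun j t => hmem (φ j) t) hDc
  refine ⟨φ ∘ ψ, hφ.comp hψ, fun t ht => ?_⟩
  by_cases htD : t ∈ D
  · exact hψc t htD
  simp only [hD, mem_union, mem_insert_iff, mem_singleton_iff, not_or, mem_ofPred_eq,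
    not_not] at htD
  obtain ⟨hcont, ht0, htT⟩ := htD
  have ht0' : 0 < t := lt_of_le_of_ne ht.1 (Ne.symm ht0)
  have htT' : t < T := lt_of_le_of_ne ht.2 htT
  refine cauchySeq_tendsto_of_complete (Metric.cauchySeq_iff'.2 fun ρ hρ => ?_)
  obtain ⟨δ, hδ, hd⟩ := h'.exists_dist_interpolant_le hT hF hM ht
    (show 0 < ρ / 4 by positivity)
  obtain ⟨η, hη, hηH⟩ := Metric.continuousAt_iff.1 hcont (δ / 3) (by positivity)
  -- Little energy is released between `p < t < q`, so the state at `t` stays close to the state at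
  -- `p`, which converges.
  obtain ⟨p, hp1, hp2⟩ := exists_rat_btwn
    (show max (max (t - δ) (t - η)) 0 < t by simp [hδ, hη, ht0'])
  obtain ⟨q, hq1, hq2⟩ := exists_rat_btwn
    (show t < min (min (t + δ) (t + η)) T by simp [hδ, hη, htT'])
  simp only [max_lt_iff, lt_min_iff] at hp1 hq2
  have hpT : (p : ℝ) ∈ Icc 0 T := ⟨hp1.2.le, by linarith⟩
  have hqT : (q : ℝ) ∈ Icc 0 T := ⟨by linarith, hq2.2.le⟩
  have hHp := abs_lt.1 (hηH (x := p) (abs_lt.2 ⟨by linarith, by linarith⟩))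
  have hHq := abs_lt.1 (hηH (x := q) (abs_lt.2 ⟨by linarith, by linarith⟩))
  have hEpq : ∀ᶠ j in atTop, E j p - E j q < δ :=
    ((hHlim p hpT).sub (hHlim q hqT)).eventually (gt_mem_nhds (by linarith))
  obtain ⟨x, hx⟩ := hφc p (mem_range_self p)
  have hxρ := (hx.eventually (Metric.ball_mem_nhds x (show 0 < ρ / 4 by positivity)))
  obtain ⟨N, hN⟩ := eventually_atTop.1
    (hψ.tendsto_atTop.eventually ((hd.and hEpq).and hxρ))
  have hclose : ∀ n ≥ N, dist (interpolant T (τ (φ (ψ n))) (v (φ (ψ n))) t) x < ρ / 2 := by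
    intro n hn
    obtain ⟨⟨h1, h2⟩, h3⟩ := hN n hn
    have h4 := h1 p hpT t ht hp2.le (abs_le.2 ⟨by linarith, by linarith⟩)
      (by rw [sub_self, abs_zero]; exact hδ.le)
      (by
        have := h'.antitone_interpEnergy hT.le hM (ψ n) hq1.le
        linarith)
    rw [dist_comm] at h4
    exact (dist_triangle _ _ _).trans_lt ((add_lt_add_of_le_of_lt h4 h3).trans_eq (by ring))
  exact ⟨N, fun n hn => by
    have h1 := hclose n hn
    have h2 := hclose N le_rfl
    exact (dist_triangle_right _ _ x).trans_lt
      ((add_lt_add h1 h2).trans_eq (by ring))⟩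

/-! ### One-sided limits and jumps of a pointwise limit -/

variable {u : ℝ → X}

theorem IsSchemeSequence.antitoneOn_limit (h : IsSchemeSequence T F R ε τ v)
    (hF : EnergyAssumptions T F) (hM : TimeLipschitz T F R M)
    (hu : ∀ t ∈ Icc 0 T, Tendsto (fun j => interpolant T (τ j) (v j) t) atTop (𝓝 (u t))) :
    AntitoneOn (fun t => F t (u t) - M * t) (Icc 0 T) := fun s hs t ht hst =>
  le_of_tendsto_of_tendsto' (h.tendsto_interpEnergy hF ht (hu t ht))
    (h.tendsto_interpEnergy hF hs (hu s hs))
    fun j => h.antitone_interpEnergy (hs.1.trans hs.2) hM j hst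

/-- The limit of the interpolants converges wherever its corrected energy does. -/
theorem IsSchemeSequence.exists_tendsto_limit (h : IsSchemeSequence T F R ε τ v)
    (hT : 0 < T) (hF : EnergyAssumptions T F) (hM : TimeLipschitz T F R M)
    (hu : ∀ t ∈ Icc 0 T, Tendsto (fun j => interpolant T (τ j) (v j) t) atTop (𝓝 (u t)))
    {t : ℝ} (ht : t ∈ Icc 0 T) {l : Filter ℝ} [l.NeBot] (hl : l ≤ 𝓝 t)
    (hlT : ∀ᶠ s in l, s ∈ Icc 0 T) {L : ℝ}
    (hL : Tendsto (fun t => F t (u t) - M * t) l (𝓝 L)) : ∃ x, Tendsto u l (𝓝 x) := by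
  refine cauchy_map_iff_exists_tendsto.1 (Metric.cauchy_iff.2 ⟨inferInstance, fun ρ hρ => ?_⟩)
  obtain ⟨δ, hδ, hd⟩ := h.exists_dist_interpolant_le hT hF hM ht (half_pos hρ)
  have hev : ∀ᶠ s in l, s ∈ Icc 0 T ∧ |s - t| ≤ δ ∧ |F s (u s) - M * s - L| < δ / 2 :=
    hlT.and (Eventually.and (hl (Metric.closedBall_mem_nhds t hδ))
      (hL.eventually (Metric.ball_mem_nhds L (half_pos hδ))))
  refine ⟨u '' {s | s ∈ Icc 0 T ∧ |s - t| ≤ δ ∧ |F s (u s) - M * s - L| < δ / 2},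
    image_mem_map hev, ?_⟩
  have key : ∀ s s' : ℝ, s ≤ s' →
      (s ∈ Icc 0 T ∧ |s - t| ≤ δ ∧ |F s (u s) - M * s - L| < δ / 2) →
      (s' ∈ Icc 0 T ∧ |s' - t| ≤ δ ∧ |F s' (u s') - M * s' - L| < δ / 2) →
      dist (u s) (u s') ≤ ρ / 2 := by
    rintro s s' hss ⟨hs, hst, hsL⟩ ⟨hs', hst', hsL'⟩
    refine le_of_tendsto ((hu s hs).dist (hu s' hs')) ?_
    have h1 := abs_lt.1 hsL
    have h2 := abs_lt.1 hsL'
    have hlim := (h.tendsto_interpEnergy (M := M) hF hs (hu s hs)).sub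
      (h.tendsto_interpEnergy (M := M) hF hs' (hu s' hs'))
    filter_upwards [hd, hlim.eventually (gt_mem_nhds
      (show F s (u s) - M * s - (F s' (u s') - M * s') < δ by linarith))] with j hj hjE
    exact hj s hs s' hs' hss hst hst' hjE.le
  rintro _ ⟨s, hs, rfl⟩ _ ⟨s', hs', rfl⟩
  rcases le_total s s' with hss | hss
  · exact (key s s' hss hs hs').trans_lt (half_lt_self hρ)
  · rw [dist_comm]
    exact (key s' s hss hs' hs).trans_lt (half_lt_self hρ)

/-- The corrected energy of `u` is antitone and bounded near each side by its value at `t`, so it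
has one-sided limits, and `u` converges wherever this energy does. -/
theorem IsSchemeSequence.isRegulated (h : IsSchemeSequence T F R ε τ v)
    (hT : 0 < T) (hF : EnergyAssumptions T F) (hM : TimeLipschitz T F R M)
    (hu : ∀ t ∈ Icc 0 T, Tendsto (fun j => interpolant T (τ j) (v j) t) atTop (𝓝 (u t))) :
    IsRegulated T u := by
  have hanti := h.antitoneOn_limit hF hM hu
  intro t ht
  constructor
  · rcases ht.1.eq_or_lt with rfl | h0
    · exact ⟨u 0, Or.inl ⟨rfl, rfl⟩⟩
    · have hsub : Ioo 0 t ⊆ Icc 0 T := fun s hs => ⟨hs.1.le, hs.2.le.trans ht.2⟩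
      have hlim := (hanti.mono hsub).tendsto_nhdsWithin_Ioo_left (nonempty_Ioo.2 h0)
        ⟨F t (u t) - M * t, by
          rintro _ ⟨s, hs, rfl⟩
          exact hanti (hsub hs) ht hs.2.le⟩
      obtain ⟨x, hx⟩ := h.exists_tendsto_limit hT hF hM hu ht nhdsWithin_le_nhds
        (by filter_upwards [Ioo_mem_nhdsLT h0] with s hs using hsub hs) hlim
      exact ⟨x, Or.inr ⟨h0, hx⟩⟩
  · rcases ht.2.eq_or_lt with rfl | h0
    · exact ⟨u t, Or.inl ⟨rfl, rfl⟩⟩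
    · have hsub : Ioo t T ⊆ Icc 0 T := fun s hs => ⟨ht.1.trans hs.1.le, hs.2.le⟩
      have hlim := (hanti.mono hsub).tendsto_nhdsWithin_Ioo_right (nonempty_Ioo.2 h0)
        ⟨F t (u t) - M * t, by
          rintro _ ⟨s, hs, rfl⟩
          exact hanti ht (hsub hs) hs.1.le⟩
      obtain ⟨x, hx⟩ := h.exists_tendsto_limit hT hF hM hu ht nhdsWithin_le_nhds
        (by filter_upwards [Ioo_mem_nhdsGT h0] with s hs using hsub hs) hlim
      exact ⟨x, Or.inr ⟨h0, hx⟩⟩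

/-- Replaces the endpoint convention by a `pure` filter, so that jumps at endpoints and interior
times are treated alike. -/
theorem IsLeftLimit.exists_filter {Y : Type*} [TopologicalSpace Y] {u : ℝ → Y} {t : ℝ} {y : Y}
    (h : IsLeftLimit u t y) (ht : t ∈ Icc 0 T) : ∃ l : Filter ℝ, l.NeBot ∧ l ≤ 𝓝 t ∧
      (∀ᶠ s in l, s ∈ Icc 0 T ∧ s ≤ t) ∧ Tendsto u l (𝓝 y) := by
  rcases h with ⟨rfl, rfl⟩ | ⟨h0, hu⟩
  · exact ⟨pure 0, inferInstance, pure_le_nhds 0, eventually_pure.2 ⟨ht, le_rfl⟩,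
      tendsto_pure_nhds u 0⟩
  · refine ⟨𝓝[<] t, inferInstance, nhdsWithin_le_nhds, ?_, hu⟩
    filter_upwards [Ioo_mem_nhdsLT h0] with s hs
    exact ⟨⟨hs.1.le, hs.2.le.trans ht.2⟩, hs.2.le⟩

theorem IsRightLimit.exists_filter {Y : Type*} [TopologicalSpace Y] {u : ℝ → Y} {t : ℝ} {y : Y}
    (h : IsRightLimit T u t y) (ht : t ∈ Icc 0 T) : ∃ l : Filter ℝ, l.NeBot ∧ l ≤ 𝓝 t ∧
      (∀ᶠ s in l, s ∈ Icc 0 T ∧ t ≤ s) ∧ Tendsto u l (𝓝 y) := by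
  rcases h with ⟨rfl, rfl⟩ | ⟨h0, hu⟩
  · exact ⟨pure t, inferInstance, pure_le_nhds t, eventually_pure.2 ⟨ht, le_rfl⟩,
      tendsto_pure_nhds u t⟩
  · refine ⟨𝓝[>] t, inferInstance, nhdsWithin_le_nhds, ?_, hu⟩
    filter_upwards [Ioo_mem_nhdsGT h0] with s hs
    exact ⟨⟨ht.1.trans hs.1.le, hs.2.le⟩, hs.1.le⟩

/-- At a jump the cost of the transition is at most the released energy. -/
theorem IsSchemeSequence.cost_le (h : IsSchemeSequence T F R ε τ v)
    (hT : 0 < T) (hF : EnergyAssumptions T F) (hM : TimeLipschitz T F R M)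
    (hu : ∀ t ∈ Icc 0 T, Tendsto (fun j => interpolant T (τ j) (v j) t) atTop (𝓝 (u t)))
    {t : ℝ} (ht : t ∈ Icc 0 T) {y z : X} (hy : IsLeftLimit u t y) (hz : IsRightLimit T u t z) :
    cost F t z y ≤ F t y - F t z := by
  obtain ⟨l, hl, hlt, hlT, hly⟩ := hy.exists_filter ht
  obtain ⟨r, hr, hrt, hrT, hrz⟩ := hz.exists_filter ht
  have hball : ∀ s ∈ Icc 0 T, ‖u s‖ ≤ R := fun s hs =>
    le_of_tendsto' (hu s hs).norm fun j => h.norm_interpolant_le j s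
  have hyR : ‖y‖ ≤ R := le_of_tendsto hly.norm (hlT.mono fun s hs => hball s hs.1)
  have hzR : ‖z‖ ≤ R := le_of_tendsto hrz.norm (hrT.mono fun s hs => hball s hs.1)
  have hcont := (hF.continuous_gradX hT ht).norm
  obtain ⟨C, hC⟩ := (isCompact_closedBall (0 : X) R).exists_bound_of_continuousOn
    (hF.continuous_gradX hT ht).continuousOn
  have hseg : ∀ a b : X, ‖a‖ ≤ R → ‖b‖ ≤ R →
      LipschitzCost (fun x => ‖gradX F t x‖) a b (dist a b * C) := fun a b ha hb => by
    refine lipschitzCost_of_segment (fun _ => norm_nonneg _) fun x hx => ?_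
    rw [dist_comm, dist_eq_norm]
    exact mul_le_mul_of_nonneg_left (hC x ((convex_closedBall (0 : X) R).segment_subset
      (by simpa using ha) (by simpa using hb) hx)) (norm_nonneg _)
  have key : ∀ κ > 0, cost F t z y ≤ (1 + κ) * (F t y - F t z) + κ := by
    intro κ hκ
    obtain ⟨δ, hδ, hd⟩ := h.exists_lipschitzCost_interpolant hT hF hM ht hκ
    -- The competitor joins `z` to the discrete state at `s'` by a segment, follows the chain back
    -- to time `s`, and ends with a segment to `y`. The limit in `j` is taken here; then `s` and
    -- `s'` tend to `t`, and finally `κ → 0`.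
    have hs : ∀ s ∈ Icc 0 T, s ≤ t → |s - t| ≤ δ → ∀ s' ∈ Icc 0 T, t ≤ s' → |s' - t| ≤ δ →
        cost F t z y ≤ dist z (u s') * C + ((1 + κ) *
          ((F s (u s) - M * s) - (F s' (u s') - M * s')) + κ) + dist (u s) y * C := by
      intro s hsT hst hsδ s' hsT' hst' hsδ'
      have hlim := ((((tendsto_const_nhds (x := z)).dist (hu s' hsT')).mul_const C).add
        ((((h.tendsto_interpEnergy (M := M) hF hsT (hu s hsT)).sub
          (h.tendsto_interpEnergy (M := M) hF hsT' (hu s' hsT'))).const_mul (1 + κ)).add_const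
            κ)).add (((hu s hsT).dist (tendsto_const_nhds (x := y))).mul_const C)
      refine ge_of_tendsto hlim (hd.mono fun j hj => cost_le_of_lipschitzCost ?_)
      exact ((hseg _ _ hzR (h.norm_interpolant_le j s')).trans hcont
        (hj s hsT s' hsT' (hst.trans hst') hsδ hsδ')).trans hcont
        (hseg _ _ (h.norm_interpolant_le j s) hyR)
    have hfst : Tendsto Prod.fst (l ×ˢ r) l := tendsto_fst
    have hsnd : Tendsto Prod.snd (l ×ˢ r) r := tendsto_snd
    have hE1 : Tendsto (fun s => F s (u s) - M * s) l (𝓝 (F t y - M * t)) :=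
      hF.tendsto_comp ht hlt (hlT.mono fun _ h => h.1) hly
    have hE2 : Tendsto (fun s => F s (u s) - M * s) r (𝓝 (F t z - M * t)) :=
      hF.tendsto_comp ht hrt (hrT.mono fun _ h => h.1) hrz
    have hlim := ((((tendsto_const_nhds (x := z)).dist (hrz.comp hsnd)).mul_const C).add
      ((((hE1.comp hfst).sub (hE2.comp hsnd)).const_mul (1 + κ)).add_const κ)).add
        (((hly.comp hfst).dist (tendsto_const_nhds (x := y))).mul_const C)
    have hle := ge_of_tendsto (b := cost F t z y) hlim (by
      have hnear := Metric.closedBall_mem_nhds t hδ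
      filter_upwards [hfst.eventually (hlT.and (hlt hnear)),
        hsnd.eventually (hrT.and (hrt hnear))] with p hp hq
      exact hs p.1 hp.1.1 hp.1.2 hp.2 p.2 hq.1.1 hq.1.2 hq.2)
    rw [dist_self, dist_self] at hle
    linarith
  have hlim : Tendsto (fun κ : ℝ => (1 + κ) * (F t y - F t z) + κ) (𝓝[>] 0)
      (𝓝 ((1 + 0) * (F t y - F t z) + 0)) :=
    tendsto_nhdsWithin_of_tendsto_nhds (Continuous.tendsto (by fun_prop) 0)
  have := ge_of_tendsto hlim (eventually_mem_nhdsWithin.mono fun κ hκ => key κ hκ)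
  linarith

end Limit

end MinMov


theorem mainTheorem6 {X : Type*} [NormedAddCommGroup X] [InnerProductSpace ℝ X]
    [FiniteDimensional ℝ X] (T : ℝ) (hT : 0 < T) (F : ℝ → X → ℝ)
    (hF : MinMov.EnergyAssumptions T F) (u₀ : X) (ε τ : ℕ → ℝ)
    (hε_pos : ∀ j, 0 < ε j) (hτ_pos : ∀ j, 0 < τ j)
    (hε : Tendsto ε atTop (𝓝 0)) (hτ : Tendsto τ atTop (𝓝 0))
    (hετ : Tendsto (fun j => ε j / τ j) atTop atTop)
    (v : ℕ → ℕ → X) (hv : ∀ j, MinMov.IsDiscreteSolution T F u₀ (ε j) (τ j) (v j)) :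
    (∃ (φ : ℕ → ℕ) (u : ℝ → X), StrictMono φ ∧ ∀ t ∈ Icc 0 T,
      Tendsto (fun j => MinMov.interpolant T (τ (φ j)) (v (φ j)) t) atTop (𝓝 (u t))) ∧
    ∀ (φ : ℕ → ℕ) (u : ℝ → X), StrictMono φ →
      (∀ t ∈ Icc 0 T,
        Tendsto (fun j => MinMov.interpolant T (τ (φ j)) (v (φ j)) t) atTop (𝓝 (u t))) →
      MinMov.IsRegulated T u ∧
      ∀ t ∈ Icc 0 T, ∀ uminus uplus : X,
        MinMov.IsLeftLimit u t uminus → MinMov.IsRightLimit T u t uplus →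
        F t uminus - F t uplus = MinMov.cost F t uplus uminus := by
  obtain ⟨R, hR⟩ := hF.exists_norm_le hT u₀
  obtain ⟨M, -, hM⟩ := hF.exists_time_lipschitz hT R
  have h : MinMov.IsSchemeSequence T F R ε τ v :=
    ⟨fun j => ⟨hε_pos j, hτ_pos j, hR _ _ (hε_pos j) (hτ_pos j) _ (hv j), (hv j).2⟩, hτ, hετ⟩
  refine ⟨?_, fun φ u hφ hu => ⟨(h.comp hφ).isRegulated hT hF hM hu, ?_⟩⟩
  · obtain ⟨φ, hφ, hlim⟩ := h.exists_subseq_tendsto hT hF hM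
    choose! u hu using hlim
    exact ⟨φ, u, hφ, hu⟩
  · intro t ht uminus uplus hminus hplus
    exact le_antisymm ((le_abs_self _).trans (hF.abs_sub_le_cost hT ht _ _))
      ((h.comp hφ).cost_le hT hF hM hu ht hminus hplus)
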